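/- Let $D=(V,A)$ be a finite digraph whose vertices $V=[n]$ are voters with positive integer weights $\omega(i)$. A delegation function on $D$ is a map $d:V\to V$ with $d(i)=i$ ($i$ votes directly) or $(i,d(i))\in A$ ($i$ delegates to $d(i)$) for every $i$, such that the digraph $H_d$ with arcs $\{(i,d(i)) : d(i)\neq i\}$ is acyclic; $\Delta(D)$ is the set of these functions. The accumulated weight $\alpha_d(i)$ of a voter $i$ is the total weight of $i$ and of all voters who delegate to $i$ directly or indirectly if $d(i)=i$, and $\alpha_d(i)=0$ if $d(i)\ne i$. The decision problem WMaxP is: given $D$, $\omega$, a delegation function $d\in\Delta(D)$, a voter $i^*\in V$, a budget $k\in\mathbb N$ and a threshold $\tau\in\mathbb N$, is there a $d'\in\Delta(D)$ with $|\{i\in V: d(i)\neq d'(i)\}|\le k$ and $\alpha_{d'}(i^*)\ge\tau$? Theorem. WMaxP is fixed-parameter tractable with respect to $\mathtt{req}=\tau-\alpha_d(i^*)$, the additional weight that $i^*$ needs. That is, there are an algorithm, a computable function $f:\mathbb N\to\mathbb N$ and a constant $c$ such that the algorithm decides every instance $I$ of WMaxP in at most $f(\max(\mathtt{req},0))\cdot|I|^{c}$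 steps, where $|I|$ is the length of the encoding of $I$ with all numbers written in binary. -/

import Mathlib

/-! ### Random access machines with a step count

Programs are structured programs of the standard random access machine: finitely many registers
and finitely many one-dimensional arrays, all holding natural numbers, with indirect addressing of
the arrays. The arithmetic is addition, cut-off subtraction and halving, at unit cost per operation.
There is no multiplication, so that `t` steps produce only numbers whose bit length exceeds that of
the input and of the constants of the program by at most `t`, and the model is polynomially
equivalent to Turing machines. -/

namespace RAM

/-- Arithmetic expressions. `get a e` reads the cell of array `a` whose index is the value of `e`.
The names of registers and arrays are fixed in the program text. -/
inductive Expr : Type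
  | const (c : ℕ)
  | reg (x : ℕ)
  | get (a : ℕ) (e : Expr)
  | add (e₁ e₂ : Expr)
  | sub (e₁ e₂ : Expr)
  | half (e : Expr)

/-- Programs. `assign x e` writes the value of `e` to register `x`; `store a e₁ e₂` writes the value
of `e₂` to the cell of array `a` whose index is the value of `e₁`; the conditions of `ite` and
`loop` (a while loop) are true when the value of the expression is nonzero. -/
inductive Program : Type
  | skip
  | assign (x : ℕ) (e : Expr)
  | store (a : ℕ) (e₁ e₂ : Expr)
  | seq (P Q : Program)
  | ite (e : Expr) (P Q : Program)
  | loop (e : Expr) (P : Program)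

/-- Contents of the registers and of the arrays. -/
structure State : Type where
  reg : ℕ → ℕ
  arr : ℕ → ℕ → ℕ

/-- The value of an expression. -/
def Expr.eval (s : State) : Expr → ℕ
  | const c => c
  | reg x => s.reg x
  | get a e => s.arr a (e.eval s)
  | add e₁ e₂ => e₁.eval s + e₂.eval s
  | sub e₁ e₂ => e₁.eval s - e₂.eval s
  | half e => e.eval s / 2

/-- The number of steps for evaluating an expression: one per operation. -/
def Expr.cost : Expr → ℕ
  | const _ => 1
  | reg _ => 1
  | get _ e => e.cost + 1
  | add e₁ e₂ => e₁.cost + e₂.cost + 1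
  | sub e₁ e₂ => e₁.cost + e₂.cost + 1
  | half e => e.cost + 1

/-- The state after writing `v` to register `x`. -/
def State.setReg (s : State) (x v : ℕ) : State :=
  { s with reg := Function.update s.reg x v }

/-- The state after writing `v` to cell `i` of array `a`. -/
def State.setArr (s : State) (a i v : ℕ) : State :=
  { s with arr := Function.update s.arr a (Function.update (s.arr a) i v) }

/-- `Exec P s t s'`: started in state `s`, the program `P` halts after exactly `t` steps, in
state `s'`. -/
inductive Exec : Program → State → ℕ → State → Prop
  | skip (s : State) : Exec .skip s 1 s
  | assign (s : State) (x : ℕ) (e : Expr) :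
      Exec (.assign x e) s (e.cost + 1) (s.setReg x (e.eval s))
  | store (s : State) (a : ℕ) (e₁ e₂ : Expr) :
      Exec (.store a e₁ e₂) s (e₁.cost + e₂.cost + 1) (s.setArr a (e₁.eval s) (e₂.eval s))
  | seq {P Q : Program} {s s' s'' : State} {t t' : ℕ} :
      Exec P s t s' → Exec Q s' t' s'' → Exec (.seq P Q) s (t + t') s''
  | ite_true {e : Expr} {P Q : Program} {s s' : State} {t : ℕ} :
      e.eval s ≠ 0 → Exec P s t s' → Exec (.ite e P Q) s (e.cost + 1 + t) s'
  | ite_false {e : Expr} {P Q : Program} {s s' : State} {t : ℕ} :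
      e.eval s = 0 → Exec Q s t s' → Exec (.ite e P Q) s (e.cost + 1 + t) s'
  | loop_true {e : Expr} {P : Program} {s s' s'' : State} {t t' : ℕ} :
      e.eval s ≠ 0 → Exec P s t s' → Exec (.loop e P) s' t' s'' →
        Exec (.loop e P) s (e.cost + 1 + t + t') s''
  | loop_false {e : Expr} {P : Program} {s : State} :
      e.eval s = 0 → Exec (.loop e P) s (e.cost + 1) s

/-- The initial state on an input `l`: the numbers of `l` stand in array `0`, from cell `0` on, and
every other cell and every register holds `0`. -/
def input (l : List ℕ) : State where
  reg := fun _ => 0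
  arr := fun a i => if a = 0 then l.getD i 0 else 0

/-- The size of an input: the length of its binary encoding, with one separator per number. -/
def inputSize (l : List ℕ) : ℕ := (l.map fun a => Nat.size a + 1).sum

end RAM

/-- Fixed-parameter tractability of the decision problem whose instances `x : α` are encoded as
`encode x`, whose yes-instances are given by `yes`, with respect to the parameter `κ`: one program
decides every instance (its answer, in register `0`, being `1` for yes and `0` for no) within
`f (κ x) * |x| ^ c` steps, where `f` is computable, `c` is a constant and `|x|` is the length of the
binary encoding of `x`. -/
def FixedParameterTractable {α : Type} (encode : α → List ℕ) (yes : α → Prop) (κ : α → ℕ) : Prop :=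
  ∃ (P : RAM.Program) (f : ℕ → ℕ) (c : ℕ), Computable f ∧
    ∀ x : α, ∃ (t : ℕ) (s : RAM.State),
      RAM.Exec P (RAM.input (encode x)) t s ∧
      t ≤ f (κ x) * RAM.inputSize (encode x) ^ c ∧
      (yes x → s.reg 0 = 1) ∧ (¬ yes x → s.reg 0 = 0)

/-! ### Liquid democracy elections -/

namespace LiquidDemocracy

/-- The delegation digraph `H_d`. -/
def delegationGraph {V : Type} (d : V → V) : Digraph V where
  Adj i j := i ≠ j ∧ d i = j

/-- `Δ(D)`: the delegation functions on `D` whose delegation digraph is acyclic. A voter votes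
directly (`d i = i`) or delegates to an out-neighbour. -/
def delegations {V : Type} (D : Digraph V) : Set (V → V) :=
  {d | (∀ i, d i = i ∨ D.Adj i (d i)) ∧
    ∀ i, ¬ Relation.TransGen (delegationGraph d).Adj i i}

/-- The vertex set of `T_d(i)`: the voter `i` and all who delegate to `i`, directly or
indirectly. -/
def subtree {V : Type} (d : V → V) (i : V) : Set V :=
  {j | Relation.ReflTransGen (delegationGraph d).Adj j i}

open Classical in
/-- The accumulated weight `α_d(i)`: the weight of `T_d(i)` if `i` is a guru, and `0` otherwise. -/
noncomputable def accWeight {V : Type} [Fintype V] (ω : V → ℕ) (d : V → V) (i : V) : ℕ :=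
  if d i = i then ∑ j with j ∈ subtree d i, ω j else 0

/-- A partial liquid democracy election `⟨D, ω, d⟩` with voters `V = [n]`. -/
structure PLDE (n : ℕ) : Type where
  D : Digraph (Fin n)
  ω : Fin n → ℕ
  ω_pos : ∀ i, 0 < ω i
  d : Fin n → Fin n
  d_mem : d ∈ delegations D

/-- An instance of WMaxP: an election, the target voter `i*`, the budget `k` and the
threshold `τ`. -/
structure WMaxPInstance : Type where
  n : ℕ
  E : PLDE n
  target : Fin n
  k : ℕ
  τ : ℕ

namespace WMaxPInstance

/-- The question of WMaxP. -/
def IsYes (I : WMaxPInstance) : Prop :=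
  ∃ d' ∈ delegations I.E.D, {i | I.E.d i ≠ d' i}.ncard ≤ I.k ∧
    I.τ ≤ accWeight I.E.ω d' I.target

/-- `req = τ - α_d(i*)`. -/
noncomputable def req (I : WMaxPInstance) : ℤ :=
  (I.τ : ℤ) - (accWeight I.E.ω I.E.d I.target : ℤ)

open Classical in
/-- The encoding of an instance: `n, i*, k, τ`, the weights, the delegations, and the adjacency
matrix of `D`, row by row. -/
noncomputable def encode (I : WMaxPInstance) : List ℕ :=
  [I.n, (I.target : ℕ), I.k, I.τ] ++
    List.ofFn I.E.ω ++
    List.ofFn (fun i => (I.E.d i : ℕ)) ++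
    List.ofFn (fun p : Fin (I.n * I.n) => if I.E.D.Adj p.divNat p.modNat then 1 else 0)

end WMaxPInstance

end LiquidDemocracy

/-! ### Programs with bounded loops -/

namespace RAM

/-! Let r be the weight that the tree of the target in `d` lacks; r is at most max(req, 0). Weights
are positive, so a solution is witnessed by at most r voters outside that tree, of total weight at
least r, that an in-tree rooted at the target collects. In this in-tree an arc of `d` is free and
any other arc costs one change (`exists_der_of_isYes`). Conversely, few added arcs always yield a
delegation function with few changes: every voter that can reach the target follows a shortest walk
to it, which makes acyclicity automatic (`exists_delegation`). What remains is to search for a cheap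
in-tree without counting a voter twice.

Colour coding does this. List the chosen voters in depth-first order and colour each with the weight
of those before it, cut off at r. A table entry for (v, a, c) bounds the number of paid arcs by
which voters with colours in [a, c), of weight at least c - a, reach v. Entries for (v, a, b) and
(u, b, c) combine along an arc from u to v, because disjoint colour intervals give disjoint sets of
voters (`Sem.attach`). Small entries are sound for any colouring (`Sound`), and under a suitable
colouring n rounds of relaxation find the tree (`run_rounds`).

Suitable colourings are found by exhaustion. At most r voters are told apart by r of the bits of
their numbers (`exists_separating_bits`), so r bit positions and a table of 2^r colours describe a
colouring. This is a number with m = r + 2^r digits in base B, where B is about log n + r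
(`exists_code`). Since B^m ≤ m! · 2^(B+m), the number of codes is at most a function of r times n
(`codes_le`).

The algorithm uses only counted loops, nested at most seven deep, whose bounds sit in registers with
values at most Y = `factor r * n` (`Ready.reg_le`). Hence it takes at most a constant times Y^7
steps (`Cmd.exec`). -/

instance : Add Expr := ⟨Expr.add⟩
instance : Sub Expr := ⟨Expr.sub⟩
instance (n : ℕ) : OfNat Expr n := ⟨Expr.const n⟩

@[simp] theorem Expr.eval_ofNat (s : State) (n : ℕ) :
    (ofNat(n) : Expr).eval s = (OfNat.ofNat n : ℕ) := rfl
@[simp] theorem Expr.eval_add (s : State) (e₁ e₂ : Expr) :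
    (e₁ + e₂).eval s = e₁.eval s + e₂.eval s := rfl
@[simp] theorem Expr.eval_sub (s : State) (e₁ e₂ : Expr) :
    (e₁ - e₂).eval s = e₁.eval s - e₂.eval s := rfl
@[simp] theorem Expr.eval_reg (s : State) (x : ℕ) : (Expr.reg x).eval s = s.reg x := rfl
@[simp] theorem Expr.eval_get (s : State) (a : ℕ) (e : Expr) :
    (Expr.get a e).eval s = s.arr a (e.eval s) := rfl
@[simp] theorem Expr.eval_half (s : State) (e : Expr) : e.half.eval s = e.eval s / 2 := rfl

@[simp] theorem State.setReg_reg (s : State) (x v y : ℕ) :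
    (s.setReg x v).reg y = if y = x then v else s.reg y := by
  simp [State.setReg, Function.update_apply]
@[simp] theorem State.setReg_arr (s : State) (x v : ℕ) : (s.setReg x v).arr = s.arr := rfl
@[simp] theorem State.setArr_reg (s : State) (a i v : ℕ) : (s.setArr a i v).reg = s.reg := rfl
theorem State.setArr_arr_ne (s : State) {a b : ℕ} (i v : ℕ) (h : b ≠ a) :
    (s.setArr a i v).arr b = s.arr b := by
  simp [State.setArr, h]
@[simp] theorem State.setArr_arr (s : State) (a i v b j : ℕ) :
    (s.setArr a i v).arr b j = if b = a ∧ j = i then v else s.arr b j := by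
  by_cases h : b = a
  · subst h; by_cases h' : j = i <;> simp [State.setArr, h']
  · simp [State.setArr, h]

/-- Programs whose only loops are `rep x b P`, which runs `P` for `x = 0, 1, …` below the value of
register `b`. -/
inductive Cmd : Type
  | assign (x : ℕ) (e : Expr)
  | store (a : ℕ) (e₁ e₂ : Expr)
  | seq (P Q : Cmd)
  | cond (e : Expr) (P : Cmd)
  | rep (x b : ℕ) (P : Cmd)

namespace Cmd

infixr:60 " ;; " => Cmd.seq

/-- The translation into a program of the random access machine. -/
def compile : Cmd → Program
  | assign x e => .assign x e
  | store a e₁ e₂ => .store a e₁ e₂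
  | seq P Q => .seq P.compile Q.compile
  | cond e P => .ite e P.compile .skip
  | rep x b P => .seq (.assign x (.const 0)) (.loop (.sub (.reg b) (.reg x))
      (.seq P.compile (.assign x (.add (.reg x) (.const 1)))))

/-- The registers that a program writes. -/
def wr : Cmd → List ℕ
  | assign x _ => [x]
  | store _ _ _ => []
  | seq P Q => P.wr ++ Q.wr
  | cond _ P => P.wr
  | rep x _ P => x :: P.wr

/-- The arrays that a program writes. -/
def wa : Cmd → List ℕ
  | assign _ _ => []
  | store a _ _ => [a]
  | seq P Q => P.wa ++ Q.wa
  | cond _ P => P.wa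
  | rep _ _ P => P.wa

/-- The registers that bound the loops of a program. -/
def bounds : Cmd → List ℕ
  | assign _ _ => []
  | store _ _ _ => []
  | seq P Q => P.bounds ++ Q.bounds
  | cond _ P => P.bounds
  | rep _ b P => b :: P.bounds

/-- No loop body writes the loop variable. -/
def WF : Cmd → Bool
  | assign _ _ => true
  | store _ _ _ => true
  | seq P Q => P.WF && Q.WF
  | cond _ P => P.WF
  | rep x _ P => P.WF && !decide (x ∈ P.wr)

/-- The states of a loop with loop variable `x` and body `f`. -/
def iter (f : State → State) (x : ℕ) (s : State) : ℕ → State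
  | 0 => s.setReg x 0
  | i + 1 => (f (iter f x s i)).setReg x (i + 1)

/-- The state in which a program ends. -/
def run : Cmd → State → State
  | assign x e, s => s.setReg x (e.eval s)
  | store a e₁ e₂, s => s.setArr a (e₁.eval s) (e₂.eval s)
  | seq P Q, s => Q.run (P.run s)
  | cond e P, s => if e.eval s = 0 then s else P.run s
  | rep x b P, s => iter P.run x s (s.reg b)

/-- A bound for the running time when register `b` holds at most `ρ b`, for all registers `b` that
bound loops. -/
def cost (ρ : ℕ → ℕ) : Cmd → ℕ
  | assign _ e => e.cost + 1
  | store _ e₁ e₂ => e₁.cost + e₂.cost + 1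
  | seq P Q => P.cost ρ + Q.cost ρ
  | cond e P => e.cost + 2 + P.cost ρ
  | rep _ b P => ρ b * (P.cost ρ + 8) + 6

/-- The nesting depth of the loops. -/
def depth : Cmd → ℕ
  | assign _ _ => 0
  | store _ _ _ => 0
  | seq P Q => max P.depth Q.depth
  | cond _ P => P.depth
  | rep _ _ P => P.depth + 1

/-- Each level of nesting contributes one factor `Y`. The constant is the cost with all loop bounds
equal to one, so it depends on the program text only. -/
theorem cost_le_pow {Y : ℕ} (hY : 1 ≤ Y) (c : Cmd) :
    c.cost (fun _ => Y) ≤ c.cost (fun _ => 1) * Y ^ c.depth := by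
  induction c with
  | assign x e => simp [cost, depth]
  | store a e₁ e₂ => simp [cost, depth]
  | seq P Q hP hQ =>
    simp only [cost, depth, add_mul]
    refine add_le_add (hP.trans ?_) (hQ.trans ?_)
    · exact Nat.mul_le_mul_left _ (Nat.pow_le_pow_right hY (le_max_left _ _))
    · exact Nat.mul_le_mul_left _ (Nat.pow_le_pow_right hY (le_max_right _ _))
  | cond e P hP =>
    simp only [cost, depth, add_mul]
    have : 1 ≤ Y ^ P.depth := Nat.one_le_pow _ _ hY
    nlinarith
  | rep x b P hP =>
    simp only [cost, depth, pow_succ]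
    have h : 1 ≤ Y ^ P.depth := Nat.one_le_pow _ _ hY
    have h' : Y ≤ Y ^ P.depth * Y := Nat.le_mul_of_pos_left _ h
    have h1 : Y * P.cost (fun _ => Y) ≤ Y * (P.cost (fun _ => 1) * Y ^ P.depth) :=
      Nat.mul_le_mul_left _ hP
    nlinarith

theorem run_reg (c : Cmd) {x : ℕ} (hx : x ∉ c.wr) (s : State) : (c.run s).reg x = s.reg x := by
  induction c generalizing s with
  | assign y e => simp only [wr, List.mem_singleton] at hx; simp [run, hx]
  | store a e₁ e₂ => simp [run]
  | seq P Q hP hQ =>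
    simp only [wr, List.mem_append, not_or] at hx
    simp [run, hP hx.1, hQ hx.2]
  | cond e P hP => simp only [run]; split_ifs <;> simp [hP hx]
  | rep y b P hP =>
    simp only [wr, List.mem_cons, not_or] at hx
    simp only [run]
    generalize s.reg b = N
    induction N with
    | zero => simp [iter, hx.1]
    | succ N ih => simp [iter, hx.1, hP hx.2, ih]

theorem run_arr (c : Cmd) {a : ℕ} (ha : a ∉ c.wa) (s : State) : (c.run s).arr a = s.arr a := by
  induction c generalizing s with
  | assign y e => simp [run]
  | store b e₁ e₂ =>
    simp only [wa, List.mem_singleton] at ha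
    simp [run, State.setArr_arr_ne _ _ _ ha]
  | seq P Q hP hQ =>
    simp only [wa, List.mem_append, not_or] at ha
    simp [run, hP ha.1, hQ ha.2]
  | cond e P hP => simp only [run]; split_ifs <;> simp [hP ha]
  | rep y b P hP =>
    simp only [wa] at ha
    simp only [run]
    generalize s.reg b = N
    induction N with
    | zero => simp [iter]
    | succ N ih => simp [iter, hP ha, ih]

/-! ### Frames and loop invariants -/

/-- The states `s` and `t` agree on all registers and arrays that `c` does not write. -/
structure Frame (c : Cmd) (s t : State) : Prop where
  reg : ∀ x, x ∉ c.wr → t.reg x = s.reg x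
  arr : ∀ a, a ∉ c.wa → t.arr a = s.arr a

theorem frame_run (c : Cmd) (s : State) : c.Frame s (c.run s) :=
  ⟨fun _ h => c.run_reg h s, fun _ h => c.run_arr h s⟩

theorem frame_iter (x b : ℕ) (P : Cmd) (s : State) (i : ℕ) :
    (rep x b P).Frame s (iter P.run x s i) := by
  induction i with
  | zero =>
    refine ⟨fun y hy => ?_, fun a _ => rfl⟩
    simp only [wr, List.mem_cons, not_or] at hy
    simp [iter, hy.1]
  | succ i ih =>
    refine ⟨fun y hy => ?_, fun a ha => ?_⟩
    · have := ih.reg y hy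
      simp only [wr, List.mem_cons, not_or] at hy
      simp [iter, hy.1, P.run_reg hy.2, this]
    · have := ih.arr a ha
      simp only [wa] at ha
      simp [iter, P.run_arr ha, this]

theorem iter_reg (f : State → State) (x : ℕ) (s : State) (i : ℕ) : (iter f x s i).reg x = i := by
  cases i <;> simp [iter]

/-- The invariant rule. Besides the invariant, the body may use that the loop variable holds the
iteration number and that whatever the loop does not write is as it was on entry. -/
theorem rep_induct {x b : ℕ} {P : Cmd} {s : State} (I : ℕ → State → Prop)
    (h0 : I 0 (s.setReg x 0))
    (hs : ∀ i t, i < s.reg b → t.reg x = i → (rep x b P).Frame s t → I i t →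
      I (i + 1) ((P.run t).setReg x (i + 1))) :
    I (s.reg b) ((rep x b P).run s) := by
  have : ∀ i, i ≤ s.reg b → I i (iter P.run x s i) := by
    intro i
    induction i with
    | zero => exact fun _ => h0
    | succ i ih =>
      exact fun hi => hs i _ hi (iter_reg _ _ _ _) (frame_iter _ _ _ _ _) (ih (Nat.le_of_succ_le hi))
  exact this _ le_rfl

/-- A loop whose body preserves `G`, moves the state along the preorder `R`, and achieves `Q i` in
the iteration `i`, where `Q i` is stable under moving along `R`. -/
theorem rep_collect {x b : ℕ} {P : Cmd} {s : State} {G : State → Prop} {R : State → State → Prop}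
    {Q : ℕ → State → State → Prop} (hrefl : ∀ t, R t t)
    (htrans : ∀ t₁ t₂ t₃, R t₁ t₂ → R t₂ t₃ → R t₁ t₃)
    (hQ : ∀ i t₀ t₁ t₂ t₃, R t₀ t₁ → Q i t₁ t₂ → R t₂ t₃ → Q i t₀ t₃)
    (hset : ∀ t v, G t → G (t.setReg x v)) (hRset : ∀ t v, R t (t.setReg x v))
    (hG : G s)
    (hs : ∀ i t, i < s.reg b → t.reg x = i → (rep x b P).Frame s t → G t →
      G (P.run t) ∧ R t (P.run t) ∧ Q i t (P.run t)) :
    G ((rep x b P).run s) ∧ R s ((rep x b P).run s) ∧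
      ∀ i, i < s.reg b → Q i s ((rep x b P).run s) := by
  refine rep_induct (fun i t => G t ∧ R s t ∧ ∀ j, j < i → Q j s t)
    ⟨hset _ _ hG, hRset _ _, fun _ h => absurd h (Nat.not_lt_zero _)⟩ ?_
  rintro i t hi hx hf ⟨h1, h2, h3⟩
  obtain ⟨h4, h5, h6⟩ := hs i t hi hx hf h1
  have h7 := htrans _ _ _ h5 (hRset (P.run t) (i + 1))
  refine ⟨hset _ _ h4, htrans _ _ _ h2 h7, fun j hj => ?_⟩
  rcases Nat.lt_succ_iff_lt_or_eq.mp hj with h | rfl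
  · exact hQ _ _ _ _ _ (hrefl s) (h3 j h) h7
  · exact hQ _ _ _ _ _ h2 h6 (hRset _ _)

/-! ### Termination within the cost bound -/

/-- The bounds of all loops are fixed throughout the program. -/
def Static (c : Cmd) : Bool := c.bounds.all fun b => !decide (b ∈ c.wr)

/-- The set `W` stands for the writes of the surrounding program. Passing to a subprogram keeps the
bounds disjoint from it, so a bound still has its initial value when its loop is reached, and
assuming `hρ` at the start is enough. -/
theorem exec_aux {ρ : ℕ → ℕ} (c : Cmd) (hwf : c.WF = true) {W : List ℕ} (hW : ∀ x ∈ c.wr, x ∈ W)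
    (hb : ∀ b ∈ c.bounds, b ∉ W) (s : State) (hρ : ∀ b ∈ c.bounds, s.reg b ≤ ρ b) :
    ∃ t ≤ c.cost ρ, Exec c.compile s t (c.run s) := by
  induction c generalizing s with
  | assign x e => exact ⟨_, le_rfl, .assign s x e⟩
  | store a e₁ e₂ => exact ⟨_, le_rfl, .store s a e₁ e₂⟩
  | seq P Q hP hQ =>
    simp only [WF, Bool.and_eq_true] at hwf
    simp only [wr, bounds, List.mem_append] at hW hb hρ
    obtain ⟨t, ht, h⟩ := hP hwf.1 (fun x h => hW x (.inl h)) (fun x h => hb x (.inl h)) s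
      (fun x h => hρ x (.inl h))
    obtain ⟨t', ht', h'⟩ := hQ hwf.2 (fun x h => hW x (.inr h)) (fun x h => hb x (.inr h)) (P.run s)
      (fun x h => by rw [P.run_reg fun h' => hb x (.inr h) (hW x (.inl h'))]; exact hρ x (.inr h))
    exact ⟨_, add_le_add ht ht', .seq h h'⟩
  | cond e P hP =>
    obtain ⟨t, ht, h⟩ := hP hwf hW hb s hρ
    by_cases he : e.eval s = 0
    · refine ⟨e.cost + 1 + 1, by simp only [cost]; omega, ?_⟩
      simp only [run, he, if_true]
      exact .ite_false he (.skip s)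
    · refine ⟨e.cost + 1 + t, by simp only [cost]; omega, ?_⟩
      simp only [run, he, if_false]
      exact .ite_true he h
  | rep x b P hP =>
    simp only [WF, Bool.and_eq_true, Bool.not_eq_true', decide_eq_false_iff_not] at hwf
    have hf := frame_iter x b P s
    have hbW : b ∉ W := hb b (by simp [bounds])
    have hbwr : b ∉ (rep x b P).wr := fun h => hbW (hW b h)
    -- Induction on the number `j` of iterations left. An iteration adds 4 steps for the test and 4
    -- for the counter to those of the body, and the final failing test takes 4. The initial
    -- assignment costs 2 more, which gives the 6 in `cost`.
    have key : ∀ j i, i + j = s.reg b → ∃ t ≤ j * (P.cost ρ + 8) + 4,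
        Exec (.loop (.sub (.reg b) (.reg x)) (.seq P.compile (.assign x (.add (.reg x) (.const 1)))))
          (iter P.run x s i) t (iter P.run x s (s.reg b)) := by
      intro j
      induction j with
      | zero =>
        intro i hi
        refine ⟨4, by omega, ?_⟩
        rw [show s.reg b = i by omega]
        refine .loop_false ?_
        simp only [Expr.eval]
        rw [(hf i).reg b hbwr, iter_reg]
        omega
      | succ j ih =>
        intro i hi
        obtain ⟨t', ht', h'⟩ := ih (i + 1) (by omega)
        obtain ⟨t, ht, h⟩ := hP hwf.1 (fun y hy => hW y (by simp [wr, hy]))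
          (fun y hy => hb y (by simp [bounds, hy])) (iter P.run x s i) (fun y hy => by
            have hy' : y ∈ (rep x b P).bounds := by simp [bounds, hy]
            rw [(hf i).reg y fun h => hb y hy' (hW y h)]
            exact hρ y hy')
        have hend : ((P.run (iter P.run x s i)).setReg x
            ((Expr.add (.reg x) (.const 1)).eval (P.run (iter P.run x s i))))
              = iter P.run x s (i + 1) := by
          simp only [Expr.eval, iter]
          rw [P.run_reg hwf.2, iter_reg]
        have hbody := Exec.seq h (Exec.assign (P.run (iter P.run x s i)) x (.add (.reg x) (.const 1)))
        rw [hend] at hbody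
        refine ⟨_, ?_, .loop_true ?_ hbody h'⟩
        · simp only [Expr.cost]
          nlinarith
        · simp only [Expr.eval]
          rw [(hf i).reg b hbwr, iter_reg]
          omega
    obtain ⟨t, ht, h⟩ := key (s.reg b) 0 (by omega)
    refine ⟨_, ?_, .seq (.assign s x (.const 0)) h⟩
    have : s.reg b * (P.cost ρ + 8) ≤ ρ b * (P.cost ρ + 8) :=
      Nat.mul_le_mul_right _ (hρ b (by simp [bounds]))
    simp only [Expr.cost, cost]
    omega

theorem exec {Y : ℕ} (hY : 1 ≤ Y) (c : Cmd) (hwf : c.WF = true) (hst : c.Static = true) (s : State)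
    (hs : ∀ b ∈ c.bounds, s.reg b ≤ Y) :
    ∃ t ≤ c.cost (fun _ => 1) * Y ^ c.depth, Exec c.compile s t (c.run s) := by
  obtain ⟨t, ht, h⟩ := exec_aux (ρ := fun _ => Y) c hwf (fun _ h => h)
    (by simpa [Static] using hst) s hs
  exact ⟨t, ht.trans (cost_le_pow hY c), h⟩

end Cmd

end RAM

/-! ### In-trees and their weights -/

namespace LiquidDemocracy

variable {V : Type}

/-- Whether `u` may be attached to `v`: it delegates to `v`, or it can. -/
def Link (D : Digraph V) (d : V → V) (u v : V) : Prop := d u = v ∨ D.Adj u v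

open Classical in
/-- The price of attaching `u` to `v`. -/
noncomputable def price (d : V → V) (u v : V) : ℕ := if d u = v then 0 else 1

/-- `Der D d v X j t`: there is an in-tree with root `v`, with `t` arcs, of total price `j`, from
whose vertices those of the list `X` are selected, in depth-first order. -/
inductive Der (D : Digraph V) (d : V → V) : V → List V → ℕ → ℕ → Prop
  | nil (v : V) : Der D d v [] 0 0
  | own (v : V) : Der D d v [v] 0 0
  | attach {u v : V} {X Y : List V} {j j' t t' : ℕ} : Der D d v X j t → Der D d u Y j' t' →
      Link D d u v → Der D d v (X ++ Y) (j + j' + price d u v) (t + t' + 1)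

namespace Der

variable {D : Digraph V} {d : V → V}

/-- Selecting a vertex is a free choice between `own` and `nil`, so vertices can be deselected while
the arcs and their price stay. -/
theorem sublist {v : V} {X Y : List V} {j t : ℕ} (h : Der D d v X j t) (hs : Y.Sublist X) :
    Der D d v Y j t := by
  induction h generalizing Y with
  | nil v => rw [List.sublist_nil.mp hs]; exact .nil v
  | own v =>
    rcases List.sublist_singleton.mp hs with rfl | rfl
    · exact .nil v
    · exact .own v
  | attach _ _ hl ih ih' =>
    obtain ⟨Y₁, Y₂, rfl, h₁, h₂⟩ := List.sublist_append_iff.mp hs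
    exact .attach (ih h₁) (ih' h₂) hl

/-- Lets a tree grow leaf by leaf although `attach` only joins trees at the root. The leaf enters
somewhere inside the depth-first list, hence the permutation. -/
theorem insert_leaf {v u w : V} {X : List V} {j t : ℕ} (h : Der D d v X j t) (hu : u ∈ X)
    (hl : Link D d w u) : ∃ X', X'.Perm (w :: X) ∧ Der D d v X' (j + price d w u) (t + 1) := by
  induction h with
  | nil v => simp at hu
  | own v =>
    obtain rfl := List.mem_singleton.mp hu
    refine ⟨[u] ++ [w], List.Perm.swap _ _ _, ?_⟩
    simpa using Der.attach (.own u) (.own w) hl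
  | @attach u' v X Y j j' t t' hX hY hl' ih ih' =>
    rcases List.mem_append.mp hu with hu | hu
    · obtain ⟨X', hp, h'⟩ := ih hu
      refine ⟨X' ++ Y, hp.append_right Y, ?_⟩
      convert Der.attach h' hY hl' using 1 <;> ring
    · obtain ⟨Y', hp, h'⟩ := ih' hu
      refine ⟨X ++ Y', (hp.append_left X).trans List.perm_middle, ?_⟩
      convert Der.attach hX h' hl' using 1 <;> ring

end Der

/-! ### The tree of a guru as an in-tree -/

theorem mem_subtree_of_mem {d : V → V} {i u : V} (h : d u ∈ subtree d i) : u ∈ subtree d i := by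
  by_cases hu : u = d u
  · rwa [hu]
  · exact Relation.ReflTransGen.head ⟨hu, rfl⟩ h

/-- A set that misses a vertex of `subtree d i` but contains `i` misses one that delegates into
it. -/
theorem exists_boundary {d : V → V} {i w : V} {S : Set V} (hi : i ∈ S) (hw : w ∈ subtree d i)
    (hwS : w ∉ S) : ∃ u ∈ subtree d i, u ∉ S ∧ d u ∈ S := by
  induction hw using Relation.ReflTransGen.head_induction_on with
  | refl => exact absurd hi hwS
  | @head a b hab hb ih =>
    by_cases hbS : b ∈ S
    · refine ⟨a, Relation.ReflTransGen.head hab hb, hwS, ?_⟩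
      rw [hab.2]; exact hbS
    · exact ih hbS

open Classical in
/-- The tree of a guru `i`, listed, with the number of changed delegations as its price. -/
theorem exists_der [Fintype V] {D : Digraph V} {d d' : V → V} (hd' : d' ∈ delegations D) (i : V) :
    ∃ X t, X.Nodup ∧ (∀ v, v ∈ X ↔ v ∈ subtree d' i) ∧ t < Fintype.card V ∧
      Der D d i X {v | v ∈ subtree d' i ∧ v ≠ i ∧ d v ≠ d' v}.ncard t := by
  -- Grow from the root, each time adding a voter whose delegate is already listed; `m + 1` vertices
  -- then carry `m` arcs. The root is excluded from the count of changes since it has no arc in the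
  -- tree.
  have key : ∀ m, m < (Finset.univ.filter fun v => v ∈ subtree d' i).card →
      ∃ X, X.Nodup ∧ X.length = m + 1 ∧ i ∈ X ∧ (∀ v ∈ X, v ∈ subtree d' i) ∧
        Der D d i X (Finset.univ.filter fun v => v ∈ X ∧ v ≠ i ∧ d v ≠ d' v).card m := by
    intro m
    induction m with
    | zero =>
      refine fun _ => ⟨[i], by simp, by simp, by simp, ?_, ?_⟩
      · intro v hv
        obtain rfl := List.mem_singleton.mp hv
        exact Relation.ReflTransGen.refl
      · convert Der.own (D := D) (d := d) i
        rw [Finset.card_eq_zero, Finset.filter_eq_empty_iff]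
        rintro v - ⟨h1, h2, -⟩
        exact h2 (List.mem_singleton.mp h1)
    | succ m ih =>
      intro hm
      obtain ⟨X, hX, hlen, hiX, hsub, hder⟩ := ih (by omega)
      obtain ⟨w, hw, hwX⟩ : ∃ w ∈ subtree d' i, w ∉ X := by
        by_contra! hcon
        have : (Finset.univ.filter fun v => v ∈ subtree d' i).card ≤ X.toFinset.card :=
          Finset.card_le_card fun v hv => by simpa using hcon v (by simpa using hv)
        have := X.toFinset_card_le
        omega
      obtain ⟨u, hu, huX, hduX⟩ := exists_boundary (S := {v | v ∈ X}) hiX hw hwX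
      have hne : d' u ≠ u := fun h => huX (by simpa [h] using hduX)
      obtain ⟨X', hp, hder'⟩ := hder.insert_leaf (w := u) hduX
        (Or.inr ((hd'.1 u).resolve_left hne))
      refine ⟨X', hp.nodup_iff.mpr (List.nodup_cons.mpr ⟨huX, hX⟩), ?_, ?_, ?_, ?_⟩
      · rw [hp.length_eq, List.length_cons, hlen]
      · exact hp.mem_iff.mpr (List.mem_cons_of_mem _ hiX)
      · intro v hv
        rcases List.mem_cons.mp (hp.mem_iff.mp hv) with rfl | h
        · exact hu
        · exact hsub v h
      · convert hder' using 1
        have hui : u ≠ i := fun h => huX (h ▸ hiX)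
        -- The price of the new arc is one exactly if `u` enlarges the set of changed voters.
        by_cases hc : d u = d' u
        · rw [price, if_pos hc, add_zero]
          congr 1
          ext v
          simp only [Finset.mem_filter, Finset.mem_univ, true_and, hp.mem_iff, List.mem_cons]
          constructor
          · rintro ⟨rfl | h, h1, h2⟩
            · exact absurd hc h2
            · exact ⟨h, h1, h2⟩
          · rintro ⟨h, h1, h2⟩
            exact ⟨.inr h, h1, h2⟩
        · rw [price, if_neg hc, ← Finset.card_insert_of_notMem (a := u)
            (by simpa using fun h => absurd h huX)]
          congr 1
          ext v
          simp only [Finset.mem_filter, Finset.mem_univ, true_and, hp.mem_iff, List.mem_cons,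
            Finset.mem_insert]
          constructor
          · rintro ⟨rfl | h, h1, h2⟩
            · exact .inl rfl
            · exact .inr ⟨h, h1, h2⟩
          · rintro (rfl | ⟨h, h1, h2⟩)
            · exact ⟨.inl rfl, hui, hc⟩
            · exact ⟨.inr h, h1, h2⟩
  have hpos : 0 < (Finset.univ.filter fun v => v ∈ subtree d' i).card :=
    Finset.card_pos.mpr ⟨i, Finset.mem_filter.mpr ⟨Finset.mem_univ _, Relation.ReflTransGen.refl⟩⟩
  obtain ⟨X, hX, hlen, hiX, hsub, hder⟩ := key _ (Nat.sub_lt hpos one_pos)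
  have hmem : ∀ v, v ∈ X ↔ v ∈ subtree d' i := by
    intro v
    refine ⟨hsub v, fun hv => ?_⟩
    have h1 : X.toFinset ⊆ Finset.univ.filter fun v => v ∈ subtree d' i := fun v hv => by
      simpa using hsub v (by simpa using hv)
    have h2 := Finset.eq_of_subset_of_card_le h1 (by
      rw [List.toFinset_card_of_nodup hX]; omega)
    have : v ∈ X.toFinset := by rw [h2]; simpa using hv
    simpa using this
  have hcard : {v | v ∈ subtree d' i ∧ v ≠ i ∧ d v ≠ d' v}.ncard =
      (Finset.univ.filter fun v => v ∈ X ∧ v ≠ i ∧ d v ≠ d' v).card := by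
    rw [← Set.ncard_coe_finset]
    congr 1
    ext v
    simp [hmem]
  refine ⟨X, _, hX, hmem, ?_, hcard ▸ hder⟩
  have := Finset.card_le_univ (Finset.univ.filter fun v => v ∈ subtree d' i)
  omega

/-! ### From additional arcs to a delegation function -/

/-- Arcs of `H_d` together with the additional arcs `P`. -/
def Step (d : V → V) (P : Finset (V × V)) (u v : V) : Prop := d u = v ∨ (u, v) ∈ P

/-- A walk of the given length leads from a vertex to `i`. -/
inductive PathLength (d : V → V) (P : Finset (V × V)) (i : V) : ℕ → V → Prop
  | zero : PathLength d P i 0 i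
  | succ {u v : V} {m : ℕ} : Step d P u v → PathLength d P i m v → PathLength d P i (m + 1) u

theorem exists_pathLength {d : V → V} {P : Finset (V × V)} {i u : V}
    (h : Relation.ReflTransGen (Step d P) u i) : ∃ m, PathLength d P i m u := by
  induction h using Relation.ReflTransGen.head_induction_on with
  | refl => exact ⟨0, .zero⟩
  | head h _ ih =>
    obtain ⟨m, hm⟩ := ih
    exact ⟨_, .succ h hm⟩

/-- Few additional arcs make a delegation function with few changes in which all vertices that reach
`i` delegate to it. -/
theorem exists_delegation [Fintype V] {D : Digraph V} {d : V → V} (hd : d ∈ delegations D)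
    (P : Finset (V × V)) (hP : ∀ p ∈ P, D.Adj p.1 p.2) (i : V) :
    ∃ d' ∈ delegations D, d' i = i ∧
      (∀ u, Relation.ReflTransGen (Step d P) u i → u ∈ subtree d' i) ∧
      {u | u ≠ i ∧ d u ≠ d' u}.ncard ≤ P.card := by
  classical
  -- On the set `U` of voters that reach `i`, the new function moves along a shortest walk;
  -- elsewhere it is `d`. It leaves both `U` and the complement invariant, because a voter whose
  -- delegate reaches `i` reaches `i` too. A cycle would thus lie in `U`, where the distance `l`
  -- strictly drops, or outside, where it would be a cycle of `d`.
  let U : Set V := {u | Relation.ReflTransGen (Step d P) u i}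
  have hlen : ∀ u ∈ U, ∃ m, PathLength d P i m u := fun u hu => exists_pathLength hu
  have hiff : ∀ u m, PathLength d P i m u → u ∈ U := by
    intro u m h
    induction h with
    | zero => exact Relation.ReflTransGen.refl
    | succ h _ ih => exact Relation.ReflTransGen.head h ih
  let l : V → ℕ := fun u => if h : u ∈ U then Nat.find (hlen u h) else 0
  have hnext : ∀ u ∈ U, u ≠ i → ∃ v ∈ U, Step d P u v ∧ l v < l u := by
    intro u hu hne
    have h := Nat.find_spec (hlen u hu)
    have hl : l u = Nat.find (hlen u hu) := dif_pos hu
    rw [← hl] at h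
    generalize l u = m at h
    cases h with
    | zero => exact absurd rfl hne
    | @succ _ v m hs hv =>
      have hvU := hiff _ _ hv
      refine ⟨v, hvU, hs, ?_⟩
      have : l v ≤ m := by
        simp only [l, dif_pos hvU]
        exact Nat.find_min' _ hv
      omega
  choose! next hnU hnS hnl using hnext
  let d' : V → V := fun u => if u = i then i else if u ∈ U then next u else d u
  have hd'i : d' i = i := by simp [d']
  have hd'U : ∀ u ∈ U, u ≠ i → d' u = next u := fun u hu hne => by simp [d', hu, hne]
  have hiU : i ∈ U := Relation.ReflTransGen.refl
  have hd'n : ∀ u ∉ U, d' u = d u := fun u hu => by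
    have : u ≠ i := fun h => hu (h ▸ hiU)
    simp [d', hu, this]
  have harc : ∀ u v, (delegationGraph d').Adj u v →
      (u ∈ U → v ∈ U ∧ l v < l u) ∧ (u ∉ U → v ∉ U ∧ (delegationGraph d).Adj u v) := by
    rintro u v ⟨hne, rfl⟩
    refine ⟨fun hu => ?_, fun hu => ?_⟩
    · have hui : u ≠ i := fun h => hne (by rw [h, hd'i])
      rw [hd'U u hu hui]
      exact ⟨hnU u hu hui, hnl u hu hui⟩
    · rw [hd'n u hu] at hne ⊢
      exact ⟨fun h => hu (Relation.ReflTransGen.head (Or.inl rfl) h), hne, rfl⟩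
  have htrans : ∀ u v, Relation.TransGen (delegationGraph d').Adj u v →
      (u ∈ U → v ∈ U ∧ l v < l u) ∧
        (u ∉ U → v ∉ U ∧ Relation.TransGen (delegationGraph d).Adj u v) := by
    intro u v h
    induction h with
    | single h => exact ⟨(harc _ _ h).1, fun hu => ⟨((harc _ _ h).2 hu).1, .single ((harc _ _ h).2 hu).2⟩⟩
    | tail _ h ih =>
      refine ⟨fun hu => ?_, fun hu => ?_⟩
      · obtain ⟨h1, h2⟩ := ih.1 hu
        obtain ⟨h3, h4⟩ := (harc _ _ h).1 h1
        exact ⟨h3, h4.trans h2⟩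
      · obtain ⟨h1, h2⟩ := ih.2 hu
        obtain ⟨h3, h4⟩ := (harc _ _ h).2 h1
        exact ⟨h3, h2.tail h4⟩
  refine ⟨d', ⟨fun u => ?_, fun u hu => ?_⟩, hd'i, fun u hu => ?_, ?_⟩
  · by_cases hui : u = i
    · exact .inl (hui ▸ hd'i)
    by_cases hu : u ∈ U
    · rw [hd'U u hu hui]
      rcases hnS u hu hui with h | h
      · rw [← h]; exact hd.1 u
      · exact .inr (hP _ h)
    · rw [hd'n u hu]; exact hd.1 u
  · by_cases h : u ∈ U
    · exact lt_irrefl _ ((htrans u u hu).1 h).2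
    · exact hd.2 u ((htrans u u hu).2 h).2
  · have : ∀ m, ∀ u ∈ U, l u = m → u ∈ subtree d' i := by
      intro m
      induction m using Nat.strong_induction_on with
      | _ m ih =>
        intro u hu hm
        by_cases hui : u = i
        · rw [hui]; exact Relation.ReflTransGen.refl
        · refine mem_subtree_of_mem ?_
          rw [hd'U u hu hui]
          exact ih _ (hm ▸ hnl u hu hui) _ (hnU u hu hui) rfl
    exact this _ u hu rfl
  -- A changed voter other than `i` moves along an arc of `P`, as a step of `d` is no change, and
  -- different voters use arcs with different tails.
  · rw [← Set.ncard_coe_finset P]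
    refine Set.ncard_le_ncard_of_injOn (fun u => (u, d' u)) ?_ ?_ (Set.toFinite _)
    · rintro u ⟨hui, hne⟩
      by_cases hu : u ∈ U
      · rw [hd'U u hu hui] at hne ⊢
        exact (hnS u hu hui).resolve_left hne
      · exact absurd (hd'n u hu).symm hne
    · intro u _ v _ h
      exact (Prod.ext_iff.mp h).1

/-! ### Table entries and colourings -/

/-- What a table entry `j` for the vertex `v` and the colours from `a` to `c` certifies: `j`
additional arcs suffice for vertices with these colours and total weight `c - a` to reach `v`. -/
def Sem (D : Digraph V) (d : V → V) (ω : V → ℕ) (U : Set V) (col : V → ℕ) (v : V) (a c j : ℕ) :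
    Prop :=
  ∃ (P : Finset (V × V)) (X : Finset V), P.card ≤ j ∧ (∀ p ∈ P, D.Adj p.1 p.2) ∧
    (∀ u ∈ X, u ∉ U ∧ a ≤ col u ∧ col u < c ∧ Relation.ReflTransGen (Step d P) u v) ∧
    a ≤ c ∧ c ≤ a + ∑ u ∈ X, ω u

namespace Sem

variable {D : Digraph V} {d : V → V} {ω : V → ℕ} {U : Set V} {col : V → ℕ}

theorem refl (v : V) (a : ℕ) : Sem D d ω U col v a a 0 :=
  ⟨∅, ∅, by simp, by simp, by simp, le_rfl, by simp⟩

theorem mono {v : V} {a c j j' : ℕ} (h : Sem D d ω U col v a c j) (hj : j ≤ j') :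
    Sem D d ω U col v a c j' := by
  obtain ⟨P, X, hP, h⟩ := h
  exact ⟨P, X, hP.trans hj, h⟩

theorem own {v : V} {a c : ℕ} (hv : v ∉ U) (hcol : col v = a) (hac : a ≤ c) (hc : c ≤ a + ω v) :
    Sem D d ω U col v a c 0 := by
  -- For `c = a` the colour interval is empty and `v` may not be used, but then nothing has to be
  -- collected.
  rcases hac.eq_or_lt with rfl | hlt
  · exact refl v a
  · refine ⟨∅, {v}, by simp, by simp, ?_, hac, by simpa using hc⟩
    intro u hu
    obtain rfl := Finset.mem_singleton.mp hu
    exact ⟨hv, hcol.ge, by omega, .refl⟩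

/-- The sets collected below `v` and below `u` have colours in the disjoint intervals [a, b) and [b,
c), so their weights add up. The arc sets may overlap, which only lowers the count. -/
theorem attach {u v : V} {a b c j j' : ℕ} (h : Sem D d ω U col v a b j)
    (h' : Sem D d ω U col u b c j') (hl : Link D d u v) :
    Sem D d ω U col v a c (j + j' + price d u v) := by
  classical
  obtain ⟨P, X, hPj, hP, hX, hab, hb⟩ := h
  obtain ⟨P', X', hPj', hP', hX', hbc, hc⟩ := h'
  -- An arc of `d` is available as a step anyway and need not be recorded; this is why it is free.
  let A : Finset (V × V) := if d u = v then ∅ else {(u, v)}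
  have hmono : ∀ {x y Q}, Q ⊆ P ∪ P' ∪ A → Relation.ReflTransGen (Step d Q) x y →
      Relation.ReflTransGen (Step d (P ∪ P' ∪ A)) x y := by
    intro x y Q hQ h
    exact Relation.ReflTransGen.mono (fun a b h => Or.imp id (fun h => hQ h) h) _ _ h
  have hstep : Step d (P ∪ P' ∪ A) u v := by
    by_cases h : d u = v
    · exact .inl h
    · exact .inr (by simp [A, h])
  refine ⟨P ∪ P' ∪ A, X ∪ X', ?_, ?_, ?_, hab.trans hbc, ?_⟩
  · have hA : A.card ≤ price d u v := by
      by_cases h : d u = v <;> simp [A, price, h]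
    have h1 := Finset.card_union_le (P ∪ P') A
    have h2 := Finset.card_union_le P P'
    omega
  · intro p hp
    simp only [Finset.mem_union] at hp
    rcases hp with (hp | hp) | hp
    · exact hP p hp
    · exact hP' p hp
    · by_cases h : d u = v
      · simp [A, h] at hp
      · simp only [A, h, if_false, Finset.mem_singleton] at hp
        rw [hp]
        exact hl.resolve_left h
  · intro x hx
    rcases Finset.mem_union.mp hx with hx | hx
    · obtain ⟨h1, h2, h3, h4⟩ := hX x hx
      exact ⟨h1, h2, by omega, hmono (fun y hy => by simp [hy]) h4⟩
    · obtain ⟨h1, h2, h3, h4⟩ := hX' x hx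
      exact ⟨h1, by omega, h3, (hmono (fun y hy => by simp [hy]) h4).tail hstep⟩
  · rw [Finset.sum_union]
    · omega
    · rw [Finset.disjoint_left]
      intro x hx hx'
      have := (hX x hx).2.2.1
      have := (hX' x hx').2.1
      omega

end Sem

/-- The list `X` lies outside `U`, and the colour of each member is the total weight of the earlier
ones, from `a` on, cut off at `r`. -/
def Coloured (ω : V → ℕ) (U : Set V) (col : V → ℕ) (r : ℕ) : ℕ → List V → Prop
  | _, [] => True
  | a, v :: X => v ∉ U ∧ col v = min a r ∧ Coloured ω U col r (a + ω v) X

/-- The second block starts at the weight where the first one stops. This matches the concatenation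
in `Der.attach` with the adjacent colour intervals of `Sem.attach`. -/
theorem coloured_append {ω : V → ℕ} {U : Set V} {col : V → ℕ} {r a : ℕ} {X Y : List V} :
    Coloured ω U col r a (X ++ Y) ↔
      Coloured ω U col r a X ∧ Coloured ω U col r (a + (X.map ω).sum) Y := by
  induction X generalizing a with
  | nil => simp [Coloured]
  | cons v X ih => simp [Coloured, ih, and_assoc, add_assoc]

/-- A list without repetitions can be coloured. -/
theorem exists_coloured (ω : V → ℕ) {U : Set V} (r : ℕ) {X : List V} (hX : X.Nodup)
    (hU : ∀ v ∈ X, v ∉ U) (a : ℕ) : ∃ g : V → ℕ, (∀ v, g v ≤ r) ∧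
      ∀ col : V → ℕ, (∀ v ∈ X, col v = g v) → Coloured ω U col r a X := by
  classical
  induction X generalizing a with
  | nil => exact ⟨fun _ => 0, by simp, by simp [Coloured]⟩
  | cons v X ih =>
    rw [List.nodup_cons] at hX
    obtain ⟨g, hg, h⟩ := ih hX.2 (fun v hv => hU v (by simp [hv])) (a + ω v)
    -- The update spoils no colour of the tail since `v` does not recur there.
    refine ⟨Function.update g v (min a r), fun w => ?_, fun col hcol => ⟨hU v (by simp), ?_, ?_⟩⟩
    · by_cases hw : w = v
      · subst hw; simp
      · simp [hw, hg]
    · simpa using hcol v (by simp)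
    · refine h col fun w hw => ?_
      have : w ≠ v := fun h => hX.1 (h ▸ hw)
      simpa [this] using hcol w (by simp [hw])

end LiquidDemocracy

/-! ### Separating few numbers by few of their bits -/

/-- The bit of `x` at position `p`. -/
def bitAt (p x : ℕ) : ℕ := x / 2 ^ p % 2

/-- The number whose bits are those of `x` at the positions `pos 0, …, pos (r - 1)`. -/
def bitPattern (pos : ℕ → ℕ) (x : ℕ) : ℕ → ℕ
  | 0 => 0
  | r + 1 => bitPattern pos x r + bitPattern pos x r + bitAt (pos r) x

theorem bitAt_lt (p x : ℕ) : bitAt p x < 2 := Nat.mod_lt _ two_pos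

theorem bitPattern_lt (pos : ℕ → ℕ) (x r : ℕ) : bitPattern pos x r < 2 ^ r := by
  induction r with
  | zero => simp [bitPattern]
  | succ r ih =>
    have := bitAt_lt (pos r) x
    simp only [bitPattern, pow_succ]
    omega

theorem bitPattern_congr {pos pos' : ℕ → ℕ} {r : ℕ} (h : ∀ i < r, pos i = pos' i) (x : ℕ) :
    bitPattern pos x r = bitPattern pos' x r := by
  induction r with
  | zero => rfl
  | succ r ih => simp only [bitPattern, ih fun i hi => h i (by omega), h r (by omega)]

theorem bitAt_eq_of_bitPattern_eq {pos : ℕ → ℕ} {x y r : ℕ}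
    (h : bitPattern pos x r = bitPattern pos y r) : ∀ i < r, bitAt (pos i) x = bitAt (pos i) y := by
  induction r with
  | zero => simp
  | succ r ih =>
    have h1 := bitAt_lt (pos r) x
    have h2 := bitAt_lt (pos r) y
    simp only [bitPattern] at h
    intro i hi
    rcases Nat.lt_succ_iff_lt_or_eq.mp hi with hi | rfl
    · exact ih (by omega) i hi
    · omega

theorem exists_bitAt_ne {L x y : ℕ} (hx : x < 2 ^ L) (hy : y < 2 ^ L) (h : x ≠ y) :
    ∃ p < L, bitAt p x ≠ bitAt p y := by
  by_contra! hcon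
  apply h
  apply Nat.eq_of_testBit_eq
  intro p
  by_cases hp : p < L
  · have := hcon p hp
    simp only [bitAt] at this
    simp only [Nat.testBit_eq_decide_div_mod_eq, this]
  · have h2 : 2 ^ L ≤ 2 ^ p := Nat.pow_le_pow_right two_pos (by omega)
    rw [Nat.testBit_lt_two_pow (by omega), Nat.testBit_lt_two_pow (by omega)]

/-- One bit per element suffices: the bits that separate `Y` let a new element agree with at most
one `b` of `Y`, and one further bit tells these two apart. -/
theorem exists_separating_bits {L : ℕ} (Y : Finset ℕ) (hY : ∀ x ∈ Y, x < 2 ^ L) :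
    ∃ pos : ℕ → ℕ, (∀ i, pos i ≤ L) ∧
      ∀ x ∈ Y, ∀ y ∈ Y, (∀ i < Y.card, bitAt (pos i) x = bitAt (pos i) y) → x = y := by
  classical
  induction Y using Finset.induction_on with
  -- The default position 0 is not below `L` if `L = 0`; hence the weak bound on positions.
  | empty => exact ⟨fun _ => 0, by simp, by simp⟩
  | @insert a Y ha ih =>
    obtain ⟨pos, hpos, hsep⟩ := ih fun x hx => hY x (by simp [hx])
    rw [Finset.card_insert_of_notMem ha]
    have hne : ∀ {y}, y ∈ Y → y ≠ a := fun hy h => ha (h ▸ hy)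
    by_cases hcon : ∃ b ∈ Y, ∀ i < Y.card, bitAt (pos i) a = bitAt (pos i) b
    · obtain ⟨b, hb, hab⟩ := hcon
      obtain ⟨p, hp, hpab⟩ := exists_bitAt_ne (hY a (by simp)) (hY b (by simp [hb])) (hne hb).symm
      have key : ∀ y ∈ Y, (∀ i < Y.card + 1, bitAt (Function.update pos Y.card p i) a =
          bitAt (Function.update pos Y.card p i) y) → False := by
        intro y hy h
        have hlt : ∀ i < Y.card, bitAt (pos i) a = bitAt (pos i) y := fun i hi => by
          simpa [hi.ne] using h i (by omega)
        obtain rfl := hsep b hb y hy fun i hi => (hab i hi).symm.trans (hlt i hi)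
        exact hpab (by simpa using h Y.card (by omega))
      refine ⟨Function.update pos Y.card p, fun i => ?_, fun x hx y hy h => ?_⟩
      · by_cases hi : i = Y.card
        · subst hi; simpa using hp.le
        · simpa [hi] using hpos i
      · rcases Finset.mem_insert.mp hx with rfl | hx' <;>
          rcases Finset.mem_insert.mp hy with rfl | hy'
        · rfl
        · exact (key y hy' h).elim
        · exact (key x hx' fun i hi => (h i hi).symm).elim
        · exact hsep x hx' y hy' fun i hi => by simpa [hi.ne] using h i (by omega)
    · push Not at hcon
      refine ⟨pos, hpos, fun x hx y hy h => ?_⟩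
      rcases Finset.mem_insert.mp hx with rfl | hx' <;>
          rcases Finset.mem_insert.mp hy with rfl | hy'
      · rfl
      · obtain ⟨i, hi, hne⟩ := hcon y hy'
        exact (hne (h i (by omega))).elim
      · obtain ⟨i, hi, hne⟩ := hcon x hx'
        exact (hne (h i (by omega)).symm).elim
      · exact hsep x hx' y hy' fun i hi => h i (by omega)

/-- Some base-`B` number lists bit positions, followed by a table, from which the values of `g` on
the small set `Y` can be read off. -/
theorem exists_code {L r B : ℕ} (hB : L < B) (Y : Finset ℕ) (hY : ∀ x ∈ Y, x < 2 ^ L)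
    (hcard : Y.card ≤ r) (g : ℕ → ℕ) (hg : ∀ x, g x < B) :
    ∃ N < B ^ (r + 2 ^ r), ∀ x ∈ Y,
      N / B ^ (r + bitPattern (fun i => N / B ^ i % B) x r) % B = g x := by
  classical
  obtain ⟨pos, hpos, hsep⟩ := exists_separating_bits Y hY
  have hinj : ∀ x ∈ Y, ∀ y ∈ Y, bitPattern pos x r = bitPattern pos y r → x = y :=
    fun x hx y hy h => hsep x hx y hy fun i hi => bitAt_eq_of_bitPattern_eq h i (by omega)
  -- Well defined on the patterns that occur, as the pattern determines the member of `Y`; other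
  -- patterns get 0.
  let lab : ℕ → ℕ := fun p => if h : ∃ y ∈ Y, bitPattern pos y r = p then g h.choose else 0
  have hlab : ∀ x ∈ Y, lab (bitPattern pos x r) = g x := by
    intro x hx
    have h : ∃ y ∈ Y, bitPattern pos y r = bitPattern pos x r := ⟨x, hx, rfl⟩
    simp only [lab, dif_pos h]
    rw [hinj _ h.choose_spec.1 _ hx h.choose_spec.2]
  have hlabB : ∀ p, lab p < B := by
    intro p
    simp only [lab]
    split_ifs
    · exact hg _
    · omega
  -- The digits of the code: `r` bit positions, then one value for each of the `2 ^ r` patterns.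
  let o : Fin (r + 2 ^ r) → Fin B := fun i =>
    if (i : ℕ) < r then ⟨pos i, (hpos i).trans_lt hB⟩ else ⟨lab (i - r), hlabB _⟩
  let N := finFunctionFinEquiv o
  have hN : ∀ i : Fin (r + 2 ^ r), (N : ℕ) / B ^ (i : ℕ) % B = o i := by
    intro i
    have : finFunctionFinEquiv.symm N = o := Equiv.symm_apply_apply _ _
    rw [← this]; rfl
  refine ⟨N, N.2, fun x hx => ?_⟩
  have hpat : bitPattern (fun i => (N : ℕ) / B ^ i % B) x r = bitPattern pos x r := by
    refine bitPattern_congr (fun i hi => ?_) x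
    have hpow : 0 < 2 ^ r := Nat.two_pow_pos r
    simpa [o, hi] using hN ⟨i, by omega⟩
  have hlt := bitPattern_lt pos x r
  have := hN ⟨r + bitPattern pos x r, by omega⟩
  rw [hpat]
  simpa [o, hlab x hx] using this

namespace LiquidDemocracy

namespace WMaxPInstance

/-! ### Solutions of an instance as coloured in-trees -/

open Classical in
/-- The weight of `T_d(i*)`. -/
noncomputable def weight (I : WMaxPInstance) : ℕ := ∑ j with j ∈ subtree I.E.d I.target, I.E.ω j

/-- The weight that has to be added to `T_d(i*)`. -/
noncomputable def need (I : WMaxPInstance) : ℕ := I.τ - I.weight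

/-- One more than the number of delegations, other than that of `i*`, that may be changed when `i*`
is to be a guru; `0` if `i*` can not become one. -/
def cap (I : WMaxPInstance) : ℕ := I.k + 1 - if I.E.d I.target = I.target then 0 else 1

/-- Whether a table entry proves that the colouring `col` yields a solution. -/
def Certified (I : WMaxPInstance) (col : Fin I.n → ℕ) (j : ℕ) : Prop :=
  Sem I.E.D I.E.d I.E.ω (subtree I.E.d I.target) col I.target 0 I.need j

/-- For a guru the two agree. For a delegating target the accumulated weight is 0, so `req` is all
of `τ`, although the tree may already supply part of it. -/
theorem need_le_req (I : WMaxPInstance) : I.need ≤ I.req.toNat := by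
  classical
  simp only [need, req, accWeight, weight]
  split_ifs
  · omega
  · simp

/-- Treated apart because with threshold 0 the target may go on delegating, whereas the table only
looks for solutions in which it is a guru. -/
theorem isYes_of_zero (I : WMaxPInstance) (h : I.τ = 0) : I.IsYes :=
  ⟨I.E.d, I.E.d_mem, by simp, by omega⟩

/-- Turning a delegating target into a guru is itself one change, which no arc of the in-tree pays
for; `cap` sets it aside. -/
theorem ncard_changes {I : WMaxPInstance} {d' : Fin I.n → Fin I.n} (h : d' I.target = I.target) :
    {u | I.E.d u ≠ d' u}.ncard = {u | u ≠ I.target ∧ I.E.d u ≠ d' u}.ncard +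
      if I.E.d I.target = I.target then 0 else 1 := by
  classical
  split_ifs with hd
  · congr 1
    ext u
    simp only [Set.mem_ofPred_eq]
    exact ⟨fun hu => ⟨fun h' => hu (by rw [h', hd, h]), hu⟩, fun hu => hu.2⟩
  · rw [← Set.ncard_insert_of_notMem (a := I.target) (by simp) (Set.toFinite _)]
    congr 1
    ext u
    simp only [Set.mem_ofPred_eq, Set.mem_insert_iff]
    constructor
    · exact fun hu => (em (u = I.target)).imp id fun h' => ⟨h', hu⟩
    · rintro (rfl | hu)
      · rwa [h]
      · exact hu.2

/-- In the delegation function built from the certified arcs, the tree of the target contains its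
old tree and the certified voters. The latter lie outside the old tree, so the weights add. -/
theorem isYes_of_certified {I : WMaxPInstance} {col : Fin I.n → ℕ} {j : ℕ} (hj : j < I.cap)
    (h : I.Certified col j) : I.IsYes := by
  classical
  obtain ⟨P, X, hPj, hP, hX, -, hw⟩ := h
  obtain ⟨d', hd', hi, hreach, hcard⟩ := exists_delegation I.E.d_mem P hP I.target
  refine ⟨d', hd', ?_, ?_⟩
  · rw [ncard_changes hi]
    simp only [cap] at hj
    omega
  · rw [accWeight, if_pos hi]
    have hdisj : Disjoint (Finset.univ.filter fun v => v ∈ subtree I.E.d I.target) X := by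
      rw [Finset.disjoint_left]
      intro u hu hu'
      exact (hX u hu').1 (by simpa using hu)
    have hsub : (Finset.univ.filter fun v => v ∈ subtree I.E.d I.target) ∪ X ⊆
        Finset.univ.filter fun v => v ∈ subtree d' I.target := by
      intro u hu
      rw [Finset.mem_filter]
      refine ⟨Finset.mem_univ _, hreach u ?_⟩
      rcases Finset.mem_union.mp hu with hu | hu
      · exact Relation.ReflTransGen.mono (fun a b h => Or.inl h.2) _ _ (Finset.mem_filter.mp hu).2
      · exact (hX u hu).2.2.2
    have := Finset.sum_le_sum_of_subset (f := I.E.ω) hsub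
    rw [Finset.sum_union hdisj] at this
    simp only [need, weight] at hw
    omega

theorem exists_der_of_isYes {I : WMaxPInstance} (hτ : I.τ ≠ 0) (h : I.IsYes) :
    ∃ X j t, X.Nodup ∧ X.length ≤ I.need ∧ (∀ v ∈ X, v ∉ subtree I.E.d I.target) ∧
      j < I.cap ∧ t < I.n ∧ I.need ≤ (X.map I.E.ω).sum ∧ Der I.E.D I.E.d I.target X j t := by
  classical
  obtain ⟨d', hd', hk, hα⟩ := h
  have hi : d' I.target = I.target := by
    by_contra hne
    rw [accWeight, if_neg hne] at hα
    omega
  rw [accWeight, if_pos hi] at hα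
  obtain ⟨X, t, hX, hmem, ht, hder⟩ := exists_der (d := I.E.d) hd' I.target
  have hY : (X.filter fun v => v ∉ subtree I.E.d I.target).Sublist X := List.filter_sublist
  have hYd := hX.sublist hY
  have hYn : ∀ v ∈ X.filter fun v => v ∉ subtree I.E.d I.target, v ∉ subtree I.E.d I.target :=
    fun v hv => by simpa using (List.mem_filter.mp hv).2
  have hYw : I.need ≤ ((X.filter fun v => v ∉ subtree I.E.d I.target).map I.E.ω).sum := by
    have hsub : (Finset.univ.filter fun v => v ∈ subtree d' I.target) ⊆
        (Finset.univ.filter fun v => v ∈ subtree I.E.d I.target) ∪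
          (X.filter fun v => v ∉ subtree I.E.d I.target).toFinset := by
      intro u hu
      have hu : u ∈ subtree d' I.target := by simpa using hu
      by_cases hu' : u ∈ subtree I.E.d I.target <;> simp [hu', (hmem u).mpr hu]
    have h1 := Finset.sum_le_sum_of_subset (f := I.E.ω) hsub
    have h2 := Finset.sum_union_inter (s₁ := Finset.univ.filter fun v => v ∈ subtree I.E.d I.target)
      (s₂ := (X.filter fun v => v ∉ subtree I.E.d I.target).toFinset) (f := I.E.ω)
    have h3 : ∑ v ∈ (X.filter fun v => v ∉ subtree I.E.d I.target).toFinset, I.E.ω v = _ :=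
      List.sum_toFinset I.E.ω hYd
    simp only [need, weight]
    omega
  generalize (X.filter fun v => v ∉ subtree I.E.d I.target) = Y at hY hYd hYn hYw
  -- Every weight is at least one, so `need` of the voters outside the old tree suffice. This bounds
  -- the number of voters to be coloured by the parameter.
  refine ⟨Y.take I.need, _, t, hYd.sublist (List.take_sublist _ _), List.length_take_le _ _,
    fun v hv => hYn v (List.mem_of_mem_take hv), ?_, by simpa using ht, ?_,
    hder.sublist ((List.take_sublist _ _).trans hY)⟩
  · rw [ncard_changes hi] at hk
    refine lt_of_le_of_lt (b := {u | u ≠ I.target ∧ I.E.d u ≠ d' u}.ncard) ?_ ?_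
    · exact Set.ncard_le_ncard (fun u hu => hu.2) (Set.toFinite _)
    · simp only [cap]
      omega
  · rcases le_total I.need Y.length with hle | hle
    · have h1 := List.length_le_sum_of_one_le ((Y.take I.need).map I.E.ω) (by
        intro i hi
        obtain ⟨v, -, rfl⟩ := List.mem_map.mp hi
        exact I.E.ω_pos v)
      rw [List.length_map, List.length_take, min_eq_left hle] at h1
      exact h1
    · rwa [List.take_of_length_le hle]

end WMaxPInstance

end LiquidDemocracy

/-! ### The preparatory part of the algorithm

Registers: 0 answer, 1 number of voters, 2 target, 3 `cap`, 4 `need`, 5 number of bits of a voter,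
6 base of the codes, 7 `2 ^ need`, 8 number of digits of a code, 9 number of codes, 10 `need + 1`,
11 its square, 12 threshold; 13 to 19 are temporary and those from 20 on are loop variables.

Arrays: 0 input, 1 multiples of the number of voters, 2 marks of the voters in the tree of the
target, 3 digits of a code, 4 colours, 5 table of the dynamic program, 6 and 7 multiples of registers
11 and 10. -/

namespace LiquidDemocracy

open RAM

namespace WMaxPInstance

/-- The array that holds the input. -/
noncomputable def inp (I : WMaxPInstance) : ℕ → ℕ := (RAM.input I.encode).arr 0

/-- The base of the codes of colourings. -/
def base (I : WMaxPInstance) (r : ℕ) : ℕ := Nat.clog 2 I.n + (r + 1)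

variable (I : WMaxPInstance)

theorem inp_n : I.inp 0 = I.n := by simp [inp, RAM.input, encode]
theorem inp_target : I.inp 1 = I.target := by simp [inp, RAM.input, encode]
theorem inp_k : I.inp 2 = I.k := by simp [inp, RAM.input, encode]
theorem inp_τ : I.inp 3 = I.τ := by simp [inp, RAM.input, encode]

theorem inp_ω (v : Fin I.n) : I.inp (v + 4) = I.E.ω v := by
  simp [inp, RAM.input, encode, List.getElem?_append]

theorem inp_d (v : Fin I.n) : I.inp (v + I.n + 4) = I.E.d v := by
  simp [inp, RAM.input, encode, List.getElem?_append]

theorem inp_adj (u v : Fin I.n) : I.inp (u * I.n + v + I.n + I.n + 4) ≠ 0 ↔ I.E.D.Adj u v := by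
  have hlt : (u * I.n + v : ℕ) < I.n * I.n := by
    have := u.2; have := v.2; nlinarith
  have h : (u * I.n + v + I.n + I.n + 4 : ℕ) - 4 = u * I.n + v + I.n + I.n := by omega
  have h1 : (⟨u * I.n + v, hlt⟩ : Fin (I.n * I.n)).divNat = u := by
    ext
    simp only [Fin.coe_divNat]
    rw [mul_comm, Nat.mul_add_div (by have := u.2; omega), Nat.div_eq_of_lt v.2, add_zero]
  have h2 : (⟨u * I.n + v, hlt⟩ : Fin (I.n * I.n)).modNat = v := by
    ext
    simp only [Fin.coe_modNat]
    rw [mul_comm, Nat.mul_add_mod, Nat.mod_eq_of_lt v.2]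
  simp [inp, RAM.input, encode, List.getElem?_append, hlt, h1, h2]

end WMaxPInstance

namespace Algorithm

open RAM.Expr (reg get half)
open RAM.Cmd (assign store cond rep)

/-- The weight of a voter. -/
def weightExpr (v : Expr) : Expr := get 0 (v + 4)

/-- The delegate of a voter. -/
def delegateExpr (v : Expr) : Expr := get 0 (v + reg 1 + 4)

/-- The entry of the adjacency matrix. -/
def adjExpr (u v : Expr) : Expr := get 0 (get 1 u + v + reg 1 + reg 1 + 4)

/-- Nonzero if and only if the values differ. -/
def neExpr (e₁ e₂ : Expr) : Expr := (e₁ - e₂) + (e₂ - e₁)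

/-- Fills array `a` with the multiples of register `y` up to the multiple by register `x`. -/
def mulTable (a x y : ℕ) : Cmd := rep 20 x (store a (reg 20 + 1) (get a (reg 20) + reg y))

def readInput : Cmd :=
  assign 1 (get 0 0) ;; assign 2 (get 0 1) ;; assign 3 (get 0 2 + 1) ;; assign 12 (get 0 3) ;;
  cond (neExpr (delegateExpr (reg 2)) (reg 2)) (assign 3 (reg 3 - 1)) ;;
  assign 0 1 ;; cond (reg 12) (assign 0 0)

def markTree : Cmd :=
  rep 20 1 (rep 21 1 (cond (get 2 (delegateExpr (reg 21))) (store 2 (reg 21) 1)))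

def sumTree : Cmd :=
  rep 20 1 (cond (get 2 (reg 20)) (assign 13 (reg 13 + weightExpr (reg 20))))

def countBits : Cmd :=
  rep 20 1 (cond (reg 1 - reg 14) (assign 14 (reg 14 + reg 14) ;; assign 5 (reg 5 + 1)))

def computeNeed : Cmd :=
  mulTable 1 1 1 ;; store 2 (reg 2) 1 ;; markTree ;; sumTree ;;
  assign 4 (reg 12 - reg 13) ;; assign 10 (reg 4 + 1) ;;
  assign 14 1 ;; countBits ;; assign 6 (reg 5 + reg 10)

def computeDigits : Cmd :=
  assign 7 1 ;; rep 20 4 (assign 7 (reg 7 + reg 7)) ;; assign 8 (reg 4 + reg 7) ;;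
  mulTable 7 10 10 ;; assign 11 (get 7 (reg 10))

def multiplyByBase : Cmd :=
  assign 13 0 ;; rep 21 6 (assign 13 (reg 13 + reg 9)) ;; assign 9 (reg 13)

def computeCodes : Cmd :=
  mulTable 6 1 11 ;; assign 9 1 ;; rep 20 8 multiplyByBase

/-- The state has the input and the initial answer. -/
structure Loaded (I : WMaxPInstance) (s : State) : Prop where
  input : s.arr 0 = I.inp
  n : s.reg 1 = I.n
  target : s.reg 2 = I.target
  cap : s.reg 3 = I.cap

theorem Loaded.of_frame {I : WMaxPInstance} {s t : State} (h : Loaded I s) {c : Cmd}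
    (hf : c.Frame s t) (h0 : 0 ∉ c.wa) (h1 : 1 ∉ c.wr) (h2 : 2 ∉ c.wr) (h3 : 3 ∉ c.wr) :
    Loaded I t :=
  ⟨(hf.arr _ h0).trans h.input, (hf.reg _ h1).trans h.n, (hf.reg _ h2).trans h.target,
    (hf.reg _ h3).trans h.cap⟩

theorem Loaded.run {I : WMaxPInstance} {s : State} (h : Loaded I s) (c : Cmd)
    (h0 : 0 ∉ c.wa) (h1 : 1 ∉ c.wr) (h2 : 2 ∉ c.wr) (h3 : 3 ∉ c.wr) : Loaded I (c.run s) :=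
  h.of_frame (c.frame_run s) h0 h1 h2 h3

@[simp] theorem eval_neExpr (e₁ e₂ : Expr) (s : State) :
    (neExpr e₁ e₂).eval s = 0 ↔ e₁.eval s = e₂.eval s := by
  simp [neExpr]; omega

theorem eval_weightExpr {I : WMaxPInstance} {s : State} (hin : s.arr 0 = I.inp) {e : Expr}
    (v : Fin I.n) (he : e.eval s = v) : (weightExpr e).eval s = I.E.ω v := by
  simp [weightExpr, hin, he, I.inp_ω]

theorem eval_delegateExpr {I : WMaxPInstance} {s : State} (h : Loaded I s) {e : Expr}
    (v : Fin I.n) (he : e.eval s = v) : (delegateExpr e).eval s = I.E.d v := by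
  simp [delegateExpr, h.input, h.n, he, I.inp_d]

theorem eval_adjExpr {I : WMaxPInstance} {s : State} (h : Loaded I s) {e₁ e₂ : Expr}
    (u v : Fin I.n) (h₁ : e₁.eval s = u) (h₂ : e₂.eval s = v) (hu : s.arr 1 u = u * I.n) :
    (adjExpr e₁ e₂).eval s ≠ 0 ↔ I.E.D.Adj u v := by
  rw [← I.inp_adj]
  simp [adjExpr, h.input, h.n, h₁, h₂, hu]

/-! ### Correctness of the preparatory computations -/

theorem run_readInput (I : WMaxPInstance) : let s := readInput.run (RAM.input I.encode)
    Loaded I s ∧ s.reg 0 = (if I.τ = 0 then 1 else 0) ∧ s.reg 5 = 0 ∧ s.reg 12 = I.τ ∧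
      s.reg 13 = 0 ∧ ∀ a, a ≠ 0 → ∀ i, s.arr a i = 0 := by
  intro s
  refine ⟨⟨Cmd.run_arr _ (by decide) _, ?_, ?_, ?_⟩, ?_, ?_, ?_, ?_, ?_⟩
  iterate 7 focus
    have h := I.inp_d I.target
    have h0 : ∀ x, (RAM.input I.encode).reg x = 0 := fun _ => rfl
    have h1 : (RAM.input I.encode).arr 0 = I.inp := rfl
    by_cases hτ : I.τ = 0 <;> by_cases hd : (I.E.d I.target : ℕ) = I.target <;>
      simp [s, readInput, Cmd.run, delegateExpr, hτ, hd, h, h0, h1, WMaxPInstance.cap, Fin.ext_iff,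
        WMaxPInstance.inp_n, WMaxPInstance.inp_target, WMaxPInstance.inp_k, WMaxPInstance.inp_τ]
  · intro a ha i
    refine (congrFun (Cmd.run_arr readInput (by simp [readInput, Cmd.wa]) _) i).trans ?_
    simp [RAM.input, ha]

/-- The machine cannot multiply, so the products needed for addressing matrices are tabulated by
repeated addition. -/
theorem run_mulTable (a x y : ℕ) (hy : y ≠ 20) (s : State) (h0 : s.arr a 0 = 0) :
    ∀ i ≤ s.reg x, ((mulTable a x y).run s).arr a i = i * s.reg y := by
  refine Cmd.rep_induct (fun j t => ∀ i ≤ j, t.arr a i = i * s.reg y) ?_ ?_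
  · intro i hi
    obtain rfl := Nat.le_zero.mp hi
    simpa using h0
  · intro j t hj hx hf ih i hi
    have hyt : t.reg y = s.reg y := hf.reg y (by simp [Cmd.wr, hy])
    rcases Nat.le_succ_iff.mp hi with hi' | rfl
    · have : i ≠ j + 1 := by omega
      simp [Cmd.run, hx, ih i hi', this]
    · simp [Cmd.run, hx, hyt, ih j le_rfl, Nat.succ_mul]

/-- A round marks every voter whose delegate was marked before it. It thus adds a mark unless the
marked set is closed already, and a closed set containing the target contains its tree. -/
theorem run_markTree {I : WMaxPInstance} {s : State} (h : Loaded I s)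
    (h2 : ∀ i, s.arr 2 i = if i = I.target then 1 else 0) (v : Fin I.n) :
    (markTree.run s).arr 2 v ≠ 0 ↔ v ∈ subtree I.E.d I.target := by
  classical
  let G : State → Prop := fun t => ∀ v : Fin I.n, t.arr 2 v ≠ 0 → v ∈ subtree I.E.d I.target
  let R : State → State → Prop := fun t t' => ∀ i, t.arr 2 i ≠ 0 → t'.arr 2 i ≠ 0
  let M : State → Finset (Fin I.n) := fun t => Finset.univ.filter fun v => t.arr 2 v ≠ 0
  have hround : ∀ t, Loaded I t → G t →
      let t' := (rep 21 1 (cond (get 2 (delegateExpr (reg 21))) (store 2 (reg 21) 1))).run t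
      G t' ∧ R t t' ∧ ∀ v : Fin I.n, t.arr 2 (I.E.d v) ≠ 0 → t'.arr 2 v ≠ 0 := by
    intro t ht hG t'
    have key := Cmd.rep_collect (x := 21) (b := 1)
      (P := cond (get 2 (delegateExpr (reg 21))) (store 2 (reg 21) 1)) (s := t) (G := G) (R := R)
      (Q := fun i t t' => ∀ v : Fin I.n, v = i → t.arr 2 (I.E.d v) ≠ 0 → t'.arr 2 v ≠ 0)
      (fun _ _ h => h) (fun _ _ _ h h' i hi => h' i (h i hi))
      (fun i _ _ _ _ h1 h2 h3 v hv hd => h3 _ (h2 v hv (h1 _ hd)))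
      (fun _ _ h => h) (fun _ _ _ h => h) hG ?_
    · refine ⟨key.1, key.2.1, fun v => key.2.2 v ?_ v rfl⟩
      rw [ht.n]; exact v.2
    · intro i t hi hx hf hG
      rw [ht.n] at hi
      have ht := ht.of_frame hf (by decide) (by decide) (by decide) (by decide)
      have hde := eval_delegateExpr ht (e := reg 21) ⟨i, hi⟩ hx
      simp only [Cmd.run, Expr.eval_get, hde]
      by_cases hc : t.arr 2 (I.E.d ⟨i, hi⟩) = 0
      · simp only [hc, if_true]
        refine ⟨hG, fun _ h => h, ?_⟩
        rintro v rfl hv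
        exact absurd hc hv
      · simp only [hc, if_false, Expr.eval_reg, hx, Expr.eval_ofNat]
        refine ⟨fun v hv => ?_, fun j hj => ?_, ?_⟩
        · by_cases hvi : (v : ℕ) = i
          · subst hvi
            exact mem_subtree_of_mem (hG _ hc)
          · exact hG v (by simpa [hvi] using hv)
        · simp only [State.setArr_arr]
          split_ifs
          · simp
          · exact hj
        · rintro v rfl -
          simp
  have hsub : ∀ t : State, t.arr 2 I.target ≠ 0 →
      (∀ v : Fin I.n, t.arr 2 (I.E.d v) ≠ 0 → t.arr 2 v ≠ 0) →
      ∀ v ∈ subtree I.E.d I.target, t.arr 2 v ≠ 0 := by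
    intro t ht hcl v hv
    by_contra hne
    obtain ⟨u, -, hu, hdu⟩ := exists_boundary (S := {v : Fin I.n | t.arr 2 v ≠ 0}) ht hv
      (fun h => h hne)
    exact hu (hcl u hdu)
  -- The second alternative of the invariant starts from the single mark at the target and is
  -- impossible after `n` rounds, as it would require `n + 1` marked voters.
  have main := Cmd.rep_induct (x := 20) (b := 1)
    (P := rep 21 1 (cond (get 2 (delegateExpr (reg 21))) (store 2 (reg 21) 1))) (s := s)
    (fun i t => G t ∧ t.arr 2 I.target ≠ 0 ∧
      ((∀ v ∈ subtree I.E.d I.target, t.arr 2 v ≠ 0) ∨ i + 1 ≤ (M t).card)) ?_ ?_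
  · obtain ⟨h1, h3, h4⟩ := main
    refine ⟨h1 v, h4.resolve_right ?_ v⟩
    rw [h.n]
    have := Finset.card_le_univ (M (Cmd.run (rep 20 1 (rep 21 1 (cond (get 2 (delegateExpr (reg 21)))
      (store 2 (reg 21) 1)))) s))
    rw [Fintype.card_fin] at this
    omega
  · refine ⟨fun v hv => ?_, by simp [h2], .inr ?_⟩
    · simp only [State.setReg_arr, h2] at hv
      have : v = I.target := by
        by_contra hne
        exact hv (if_neg fun h => hne (Fin.ext h))
      rw [this]
      exact Relation.ReflTransGen.refl
    · exact Finset.card_pos.mpr ⟨I.target, by simp [M, h2]⟩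
  · rintro i t hi hx hf ⟨h1, h3, h4⟩
    obtain ⟨g1, g2, g3⟩ := hround t
      (h.of_frame hf (by decide) (by decide) (by decide) (by decide)) h1
    refine ⟨g1, g2 _ h3, ?_⟩
    rcases h4 with h4 | h4
    · exact .inl fun v hv => g2 v (h4 v hv)
    · by_cases hcl : ∀ v : Fin I.n, t.arr 2 (I.E.d v) ≠ 0 → t.arr 2 v ≠ 0
      · exact .inl fun v hv => g2 v (hsub t h3 hcl v hv)
      · push Not at hcl
        obtain ⟨u, hu, hu'⟩ := hcl
        refine .inr (Nat.succ_le_of_lt (h4.trans_lt (Finset.card_lt_card ?_)))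
        refine Finset.ssubset_iff_subset_ne.mpr ⟨fun v hv => ?_, fun heq => ?_⟩
        · exact Finset.mem_filter.mpr ⟨Finset.mem_univ _, g2 v (Finset.mem_filter.mp hv).2⟩
        · have : u ∈ M t := by
            rw [heq]
            exact Finset.mem_filter.mpr ⟨Finset.mem_univ _, g3 u hu⟩
          exact (Finset.mem_filter.mp this).2 hu'

theorem run_sumTree {I : WMaxPInstance} {s : State} (h : Loaded I s) (h13 : s.reg 13 = 0)
    (h2 : ∀ v : Fin I.n, s.arr 2 v ≠ 0 ↔ v ∈ subtree I.E.d I.target) :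
    (sumTree.run s).reg 13 = I.weight := by
  classical
  have main := Cmd.rep_induct (x := 20) (b := 1)
    (P := cond (get 2 (reg 20)) (assign 13 (reg 13 + weightExpr (reg 20)))) (s := s)
    (fun i t => t.reg 13 = ∑ j ∈ Finset.range i, if s.arr 2 j = 0 then 0 else I.inp (j + 4)) ?_ ?_
  · rw [h.n] at main
    rw [sumTree, main, Finset.sum_range, WMaxPInstance.weight, Finset.sum_filter]
    refine Finset.sum_congr rfl fun v _ => ?_
    rw [I.inp_ω]
    by_cases hv : s.arr 2 v = 0
    · rw [if_pos hv, if_neg fun h' => (h2 v).mpr h' hv]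
    · rw [if_neg hv, if_pos ((h2 v).mp hv)]
  · simpa using h13
  · intro i t hi hx hf ih
    have h2' : t.arr 2 = s.arr 2 := hf.arr 2 (by decide)
    have h0' : t.arr 0 = I.inp := (hf.arr 0 (by decide)).trans h.input
    rw [Finset.sum_range_succ, ← ih]
    by_cases hv : s.arr 2 i = 0 <;> simp [Cmd.run, hx, h2', hv, weightExpr, h0']

/-- Doubling stops at the first power of two that is at least `n`; `n` passes are enough since `n ≤
2 ^ n`. -/
theorem run_countBits {I : WMaxPInstance} {s : State} (h : Loaded I s) (h14 : s.reg 14 = 1)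
    (h5 : s.reg 5 = 0) : (countBits.run s).reg 5 = Nat.clog 2 I.n := by
  have main := Cmd.rep_induct (x := 20) (b := 1)
    (P := cond (reg 1 - reg 14) (assign 14 (reg 14 + reg 14) ;; assign 5 (reg 5 + 1))) (s := s)
    (fun i t => t.reg 14 = 2 ^ t.reg 5 ∧ t.reg 5 = min i (Nat.clog 2 I.n)) ?_ ?_
  · rw [h.n] at main
    rw [countBits, main.2, min_eq_right]
    exact Nat.clog_le_of_le_pow Nat.lt_two_pow_self.le
  · simp [h14, h5]
  · rintro i t hi hx hf ⟨h1, h2⟩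
    have hn : t.reg 1 = I.n := (hf.reg 1 (by decide)).trans h.n
    have hiff : I.n - t.reg 14 = 0 ↔ ¬ t.reg 5 < Nat.clog 2 I.n := by
      rw [Nat.lt_clog_iff_pow_lt one_lt_two, ← h1]; omega
    by_cases hc : I.n - t.reg 14 = 0
    · have := hiff.mp hc
      simp only [Cmd.run, Expr.eval_sub, Expr.eval_reg, hn, hc, if_true, State.setReg_reg]
      simp only [Nat.reduceEqDiff, if_false]
      exact ⟨h1, by omega⟩
    · have := hiff.not.mp hc
      simp only [Cmd.run, Expr.eval_sub, Expr.eval_reg, hn, hc, if_false]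
      simp [h1, pow_succ]
      omega

theorem run_computeNeed {I : WMaxPInstance} {s : State} (h : Loaded I s) (h5 : s.reg 5 = 0)
    (h12 : s.reg 12 = I.τ) (h13 : s.reg 13 = 0) (harr : ∀ a, a ≠ 0 → ∀ i, s.arr a i = 0) :
    let t := computeNeed.run s
    t.reg 4 = I.need ∧ t.reg 10 = I.need + 1 ∧ t.reg 5 = Nat.clog 2 I.n ∧
      t.reg 6 = I.base I.need ∧ (∀ u ≤ I.n, t.arr 1 u = u * I.n) ∧
      ∀ v : Fin I.n, t.arr 2 v ≠ 0 ↔ v ∈ subtree I.E.d I.target := by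
  intro t
  set s₁ := (mulTable 1 1 1).run s with hs₁
  have l₁ : Loaded I s₁ := h.run _ (by decide) (by decide) (by decide) (by decide)
  have m₁ := run_mulTable 1 1 1 (by decide) s (harr 1 (by decide) 0)
  rw [← hs₁, h.n] at m₁
  set s₂ := s₁.setArr 2 (s₁.reg 2) 1 with hs₂
  have l₂ : Loaded I s₂ := l₁.run (store 2 (reg 2) 1) (by decide) (by decide) (by decide) (by decide)
  set s₃ := markTree.run s₂ with hs₃
  have l₃ : Loaded I s₃ := l₂.run _ (by decide) (by decide) (by decide) (by decide)
  have m₃ : ∀ v : Fin I.n, s₃.arr 2 v ≠ 0 ↔ v ∈ subtree I.E.d I.target := by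
    refine run_markTree l₂ fun i => ?_
    have : s₁.arr 2 = s.arr 2 := Cmd.run_arr _ (by decide) _
    simp [hs₂, l₁.target, this, harr 2 (by decide)]
  have r₃ : ∀ x, x ≠ 20 → x ≠ 21 → s₃.reg x = s.reg x := by
    intro x hx hx'
    rw [hs₃, Cmd.run_reg _ (by simp [markTree, Cmd.wr, hx, hx']), hs₂, State.setArr_reg, hs₁,
      Cmd.run_reg _ (by simp [mulTable, Cmd.wr, hx])]
  set s₄ := sumTree.run s₃ with hs₄
  have l₄ : Loaded I s₄ := l₃.run _ (by decide) (by decide) (by decide) (by decide)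
  have m₄ : s₄.reg 13 = I.weight :=
    run_sumTree l₃ ((r₃ 13 (by decide) (by decide)).trans h13) m₃
  have h4' : s₄.reg 12 = I.τ :=
    (Cmd.run_reg _ (by decide) _).trans ((r₃ 12 (by decide) (by decide)).trans h12)
  have h5' : s₄.reg 5 = 0 :=
    (Cmd.run_reg _ (by decide) _).trans ((r₃ 5 (by decide) (by decide)).trans h5)
  set s₅ := (assign 14 1).run ((assign 10 (reg 4 + 1)).run ((assign 4 (reg 12 - reg 13)).run s₄))
    with hs₅
  have l₅ : Loaded I s₅ := l₄.run (assign 4 (reg 12 - reg 13) ;; assign 10 (reg 4 + 1) ;; assign 14 1)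
    (by decide) (by decide) (by decide) (by decide)
  have m₅ : s₅.reg 4 = I.need ∧ s₅.reg 10 = I.need + 1 ∧ s₅.reg 5 = 0 ∧ s₅.reg 14 = 1 := by
    simp [hs₅, Cmd.run, m₄, h4', h5', WMaxPInstance.need]
  set s₆ := countBits.run s₅ with hs₆
  have m₆ : s₆.reg 5 = Nat.clog 2 I.n := run_countBits l₅ m₅.2.2.2 m₅.2.2.1
  have h46 : s₆.reg 4 = I.need := (Cmd.run_reg _ (by decide) _).trans m₅.1
  have h106 : s₆.reg 10 = I.need + 1 := (Cmd.run_reg _ (by decide) _).trans m₅.2.1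
  have ht : t = (assign 6 (reg 5 + reg 10)).run s₆ := rfl
  have ha : ∀ a, a ≠ 2 → t.arr a = s₁.arr a := by
    intro a ha
    refine (Cmd.run_arr (markTree ;; sumTree ;;
      assign 4 (reg 12 - reg 13) ;; assign 10 (reg 4 + 1) ;;
      assign 14 1 ;; countBits ;; assign 6 (reg 5 + reg 10)) ?_ s₂).trans ?_
    · simp [markTree, sumTree, countBits, Cmd.wa, ha]
    · simp [hs₂, State.setArr_arr_ne _ _ _ ha]
  have ha2 : t.arr 2 = s₃.arr 2 := Cmd.run_arr (sumTree ;;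
      assign 4 (reg 12 - reg 13) ;; assign 10 (reg 4 + 1) ;;
      assign 14 1 ;; countBits ;; assign 6 (reg 5 + reg 10)) (by decide) s₃
  refine ⟨?_, ?_, ?_, ?_, fun u hu => ?_, ?_⟩
  · simp [ht, Cmd.run, h46]
  · simp [ht, Cmd.run, h106]
  · simp [ht, Cmd.run, m₆]
  · simp [ht, Cmd.run, m₆, h106, WMaxPInstance.base]
  · rw [ha 1 (by decide)]
    exact m₁ u hu
  · rw [ha2]
    exact m₃

theorem run_double (s : State) (h7 : s.reg 7 = 1) :
    ((rep 20 4 (assign 7 (reg 7 + reg 7))).run s).reg 7 = 2 ^ s.reg 4 := by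
  refine Cmd.rep_induct (fun i t => t.reg 7 = 2 ^ i) (by simpa using h7) ?_
  intro i t hi hx hf ih
  simp [Cmd.run, ih, pow_succ]
  omega

theorem run_computeDigits {s : State} {r : ℕ} (h4 : s.reg 4 = r) (h10 : s.reg 10 = r + 1)
    (h7 : s.arr 7 0 = 0) :
    let t := computeDigits.run s
    t.reg 8 = r + 2 ^ r ∧ t.reg 11 = (r + 1) * (r + 1) ∧ ∀ a ≤ r + 1, t.arr 7 a = a * (r + 1) := by
  intro t
  set s₁ := (assign 7 1).run s with hs₁
  have m₁ := run_double s₁ (by simp [hs₁, Cmd.run])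
  set s₂ := (rep 20 4 (assign 7 (reg 7 + reg 7))).run s₁ with hs₂
  have e₁ : s₁.reg 4 = r := (Cmd.run_reg _ (by decide) _).trans h4
  have e₂ : s₂.reg 4 = r := (Cmd.run_reg _ (by decide) _).trans e₁
  set s₃ := (assign 8 (reg 4 + reg 7)).run s₂ with hs₃
  have e₃ : s₃.reg 10 = r + 1 := (Cmd.run_reg (assign 7 1 ;; rep 20 4 (assign 7 (reg 7 + reg 7)) ;;
    assign 8 (reg 4 + reg 7)) (by decide) s).trans h10
  have a₃ : s₃.arr 7 = s.arr 7 := Cmd.run_arr (assign 7 1 ;; rep 20 4 (assign 7 (reg 7 + reg 7)) ;;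
    assign 8 (reg 4 + reg 7)) (by decide) s
  have m₃ : s₃.reg 8 = r + 2 ^ r := by simp [hs₃, Cmd.run, e₂, m₁, e₁]
  set s₄ := (mulTable 7 10 10).run s₃ with hs₄
  have m₄ := run_mulTable 7 10 10 (by decide) s₃ (by rw [a₃, h7])
  rw [← hs₄, e₃] at m₄
  have e₄ : s₄.reg 8 = r + 2 ^ r := (Cmd.run_reg _ (by decide) _).trans m₃
  have f₄ : s₄.reg 10 = r + 1 := (Cmd.run_reg _ (by decide) _).trans e₃
  have ht : t = (assign 11 (get 7 (reg 10))).run s₄ := rfl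
  refine ⟨?_, ?_, ?_⟩
  · simp [ht, Cmd.run, e₄]
  · simp [ht, Cmd.run, f₄, m₄]
  · simpa [ht, Cmd.run] using m₄

theorem run_multiplyByBase (s : State) : (multiplyByBase.run s).reg 9 = s.reg 9 * s.reg 6 := by
  have key := Cmd.rep_induct (x := 21) (b := 6) (P := assign 13 (reg 13 + reg 9))
    (s := (assign 13 0).run s) (fun i t => t.reg 13 = s.reg 9 * i) (by simp [Cmd.run]) ?_
  · have h6 : ((assign 13 0).run s).reg 6 = s.reg 6 := Cmd.run_reg _ (by decide) _
    rw [h6] at key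
    simpa [multiplyByBase, Cmd.run] using key
  · intro i t hi hx hf ih
    have : t.reg 9 = s.reg 9 := (hf.reg 9 (by decide)).trans (Cmd.run_reg _ (by decide) _)
    simp [Cmd.run, ih, this, Nat.mul_succ]

theorem run_computeCodes {s : State} (h6 : s.arr 6 0 = 0) :
    let t := computeCodes.run s
    t.reg 9 = s.reg 6 ^ s.reg 8 ∧ ∀ a ≤ s.reg 1, t.arr 6 a = a * s.reg 11 := by
  intro t
  set s₁ := (mulTable 6 1 11).run s with hs₁
  have m₁ := run_mulTable 6 1 11 (by decide) s h6
  set s₂ := (assign 9 1).run s₁ with hs₂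
  have e₂ : ∀ x, x ≠ 9 → x ≠ 20 → s₂.reg x = s.reg x := by
    intro x hx hx'
    rw [hs₂, Cmd.run_reg _ (by simp [Cmd.wr, hx]), hs₁, Cmd.run_reg _ (by simp [mulTable, Cmd.wr, hx'])]
  have ht : t = (rep 20 8 multiplyByBase).run s₂ := rfl
  refine ⟨?_, fun a ha => ?_⟩
  · have key := Cmd.rep_induct (x := 20) (b := 8) (P := multiplyByBase) (s := s₂)
      (fun i t => t.reg 9 = s.reg 6 ^ i) (by simp [hs₂, Cmd.run]) ?_
    · rw [e₂ 8 (by decide) (by decide)] at key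
      exact key
    · intro i t hi hx hf ih
      have : t.reg 6 = s.reg 6 := (hf.reg 6 (by decide)).trans (e₂ 6 (by decide) (by decide))
      simp [run_multiplyByBase, ih, this, pow_succ]
  · rw [ht, Cmd.run_arr _ (by decide), hs₂, Cmd.run_arr _ (by decide)]
    exact m₁ a ha

/-- The state is prepared for the main loop. -/
structure Ready (I : WMaxPInstance) (s : State) : Prop extends Loaded I s where
  need : s.reg 4 = I.need
  bits : s.reg 5 = Nat.clog 2 I.n
  base : s.reg 6 = I.base I.need
  digits : s.reg 8 = I.need + 2 ^ I.need
  codes : s.reg 9 = I.base I.need ^ (I.need + 2 ^ I.need)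
  width : s.reg 10 = I.need + 1
  row : ∀ u : Fin I.n, s.arr 1 u = u * I.n
  mark : ∀ v : Fin I.n, s.arr 2 v ≠ 0 ↔ v ∈ subtree I.E.d I.target
  plane : ∀ v : Fin I.n, s.arr 6 v = v * ((I.need + 1) * (I.need + 1))
  line : ∀ a ≤ I.need, s.arr 7 a = a * (I.need + 1)

theorem Ready.of_frame {I : WMaxPInstance} {s t : State} (h : Ready I s) {c : Cmd}
    (hf : c.Frame s t) (hr : ∀ x ∈ [1, 2, 3, 4, 5, 6, 8, 9, 10], x ∉ c.wr)
    (ha : ∀ a ∈ [0, 1, 2, 6, 7], a ∉ c.wa) : Ready I t := by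
  have hr' : ∀ x ∈ [1, 2, 3, 4, 5, 6, 8, 9, 10], t.reg x = s.reg x := fun x hx => hf.reg x (hr x hx)
  have ha' : ∀ a ∈ [0, 1, 2, 6, 7], t.arr a = s.arr a := fun a h => hf.arr a (ha a h)
  simp only [List.mem_cons, List.not_mem_nil, or_false, forall_eq_or_imp, forall_eq] at hr' ha'
  obtain ⟨a0, a1, a2, a6, a7⟩ := ha'
  obtain ⟨r1, r2, r3, r4, r5, r6, r8, r9, r10⟩ := hr'
  constructor
  · constructor
    · rw [a0, h.input]
    · rw [r1, h.n]
    · rw [r2, h.target]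
    · rw [r3, h.cap]
  · rw [r4, h.need]
  · rw [r5, h.bits]
  · rw [r6, h.base]
  · rw [r8, h.digits]
  · rw [r9, h.codes]
  · rw [r10, h.width]
  · rw [a1]; exact h.row
  · rw [a2]; exact h.mark
  · rw [a6]; exact h.plane
  · rw [a7]; exact h.line

theorem Ready.run {I : WMaxPInstance} {s : State} (h : Ready I s) (c : Cmd)
    (hr : ∀ x ∈ [1, 2, 3, 4, 5, 6, 8, 9, 10], x ∉ c.wr) (ha : ∀ a ∈ [0, 1, 2, 6, 7], a ∉ c.wa) :
    Ready I (c.run s) :=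
  h.of_frame (c.frame_run s) hr ha

theorem ready (I : WMaxPInstance) :
    let s := computeCodes.run (computeDigits.run (computeNeed.run (readInput.run
      (RAM.input I.encode))))
    Ready I s ∧ s.reg 0 = if I.τ = 0 then 1 else 0 := by
  obtain ⟨h, h0, h5, h12, h13, harr⟩ := run_readInput I
  generalize readInput.run (RAM.input I.encode) = s at *
  obtain ⟨n4, n10, n5, n6, nrow, nmark⟩ := run_computeNeed h h5 h12 h13 harr
  have hN : Loaded I (computeNeed.run s) := h.run _ (by decide) (by decide) (by decide) (by decide)
  have n0 : (computeNeed.run s).reg 0 = s.reg 0 := Cmd.run_reg _ (by decide) _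
  have na6 : (computeNeed.run s).arr 6 = s.arr 6 := Cmd.run_arr _ (by decide) _
  have na7 : (computeNeed.run s).arr 7 = s.arr 7 := Cmd.run_arr _ (by decide) _
  generalize computeNeed.run s = s₁ at *
  obtain ⟨d8, d11, dline⟩ := run_computeDigits n4 n10 (by rw [na7, harr 7 (by decide)])
  have hD : Loaded I (computeDigits.run s₁) := hN.run _ (by decide) (by decide) (by decide) (by decide)
  have dr : ∀ x ∈ [0, 4, 5, 6, 10], (computeDigits.run s₁).reg x = s₁.reg x :=
    fun x hx => Cmd.run_reg _ (by fin_cases hx <;> decide) _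
  have da : ∀ a ∈ [1, 2, 6], (computeDigits.run s₁).arr a = s₁.arr a :=
    fun x hx => Cmd.run_arr _ (by fin_cases hx <;> decide) _
  generalize computeDigits.run s₁ = s₂ at *
  obtain ⟨c9, cplane⟩ := run_computeCodes (s := s₂)
    (by rw [da 6 (by decide), na6, harr 6 (by decide)])
  have hC : Loaded I (computeCodes.run s₂) := hD.run _ (by decide) (by decide) (by decide) (by decide)
  have cr : ∀ x ∈ [0, 4, 5, 6, 8, 10], (computeCodes.run s₂).reg x = s₂.reg x :=
    fun x hx => Cmd.run_reg _ (by fin_cases hx <;> decide) _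
  have ca : ∀ a ∈ [1, 2, 7], (computeCodes.run s₂).arr a = s₂.arr a :=
    fun x hx => Cmd.run_arr _ (by fin_cases hx <;> decide) _
  simp only [List.mem_cons, List.not_mem_nil, or_false, forall_eq_or_imp, forall_eq] at dr da cr ca
  obtain ⟨dr0, dr4, dr5, dr6, dr10⟩ := dr
  obtain ⟨cr0, cr4, cr5, cr6, cr8, cr10⟩ := cr
  obtain ⟨da1, da2, da6⟩ := da
  obtain ⟨ca1, ca2, ca7⟩ := ca
  refine ⟨⟨hC, ?_, ?_, ?_, ?_, ?_, ?_, fun u => ?_, fun v => ?_, fun v => ?_, fun a ha => ?_⟩, ?_⟩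
  · rw [cr4, dr4, n4]
  · rw [cr5, dr5, n5]
  · rw [cr6, dr6, n6]
  · rw [cr8, d8]
  · rw [c9, dr6, n6, d8]
  · rw [cr10, dr10, n10]
  · rw [ca1, da1, nrow u u.2.le]
  · rw [ca2, da2, nmark]
  · rw [cplane v (by rw [hD.n]; exact v.2.le), d11]
  · rw [ca7, dline a (by omega)]
  · rw [cr0, dr0, n0, h0]

/-! ### The main part of the algorithm -/

/-- Replaces register 14 by its remainder modulo the base, with the quotient in register 13. -/
def divide : Cmd :=
  assign 13 0 ;;
  rep 22 9 (cond (reg 14 + 1 - reg 6) (assign 14 (reg 14 - reg 6) ;; assign 13 (reg 13 + 1)))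

def decode : Cmd :=
  assign 14 (reg 20) ;;
  rep 21 8 (divide ;; store 3 (reg 21) (reg 14) ;; assign 14 (reg 13))

/-- Puts the voter of register 21, shifted by digit number (register 22), into register 14. -/
def shift : Cmd :=
  assign 14 (reg 21) ;; rep 23 5 (cond (get 3 (reg 22) - reg 23) (assign 14 (half (reg 14))))

/-- The last bit of a number is obtained by subtracting twice its half. -/
def pattern : Cmd :=
  assign 13 0 ;;
  rep 22 4 (shift ;;
    assign 13 (reg 13 + reg 13 + (reg 14 - (half (reg 14) + half (reg 14)))))

def colour : Cmd := rep 21 1 (pattern ;; store 4 (reg 21) (get 3 (reg 4 + reg 13)))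

/-- The place of an entry of the table of the dynamic program. -/
def cell (v a c : Expr) : Expr := get 6 v + get 7 a + c

def fill : Cmd := rep 21 1 (rep 22 10 (rep 23 10 (store 5 (cell (reg 21) (reg 22) (reg 23)) (reg 3))))

def collect : Cmd :=
  assign 13 (reg 22 + weightExpr (reg 21)) ;;
  cond (reg 13 - reg 4) (assign 13 (reg 4)) ;;
  store 5 (cell (reg 21) (reg 22) (reg 13)) 0

def initCell : Cmd :=
  store 5 (cell (reg 21) (reg 22) (reg 22)) 0 ;;
  cond (1 - get 2 (reg 21)) (cond (1 - neExpr (get 4 (reg 21)) (reg 22)) collect)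

def init : Cmd := rep 21 1 (rep 22 10 initCell)

def relaxCell : Cmd :=
  assign 15 (get 5 (cell (reg 23) (reg 24) (reg 25)) + get 5 (cell (reg 22) (reg 25) (reg 26)) +
    reg 14) ;;
  cond (get 5 (cell (reg 23) (reg 24) (reg 26)) - reg 15)
    (store 5 (cell (reg 23) (reg 24) (reg 26)) (reg 15))

def relaxArc : Cmd := rep 24 10 (rep 25 10 (rep 26 10 relaxCell))

def relaxPair : Cmd :=
  cond (adjExpr (reg 22) (reg 23)) (assign 14 1 ;; relaxArc) ;;
  cond (1 - neExpr (delegateExpr (reg 22)) (reg 23)) (assign 14 0 ;; relaxArc)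

def round : Cmd := rep 22 1 (rep 23 1 relaxPair)

def rounds : Cmd := rep 21 1 round

def accept : Cmd := cond (reg 3 - get 5 (cell (reg 2) 0 (reg 4))) (assign 0 1)

def mainLoop : Cmd :=
  rep 20 9 (decode ;; colour ;; fill ;; init ;; rounds ;; accept)

/-! ### Decoding a colouring -/

theorem run_divide {s : State} {B x : ℕ} (hB : 0 < B) (h6 : s.reg 6 = B) (h14 : s.reg 14 = x)
    (hx : x ≤ s.reg 9) : (divide.run s).reg 14 = x % B ∧ (divide.run s).reg 13 = x / B := by
  have key := Cmd.rep_induct (x := 22) (b := 9)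
    (P := cond (reg 14 + 1 - reg 6) (assign 14 (reg 14 - reg 6) ;; assign 13 (reg 13 + 1)))
    (s := (assign 13 0).run s)
    -- Division by repeated subtraction. Each active pass removes at least one, so as many passes as
    -- there are codes suffice for any `x` up to that number.
    (fun i t => t.reg 14 + B * t.reg 13 = x ∧ (t.reg 14 < B ∨ t.reg 14 + i ≤ x)) ?_ ?_
  · obtain ⟨h1, h2⟩ := key
    have h9 : ((assign 13 0).run s).reg 9 = s.reg 9 := Cmd.run_reg _ (by decide) _
    rw [h9] at h2
    have h3 := (Nat.div_mod_unique hB).mpr ⟨h1, by omega⟩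
    exact ⟨h3.2.symm, h3.1.symm⟩
  · simp [Cmd.run, h14]
  · rintro i t hi hx hf ⟨h1, h2⟩
    have h6' : t.reg 6 = B :=
      ((hf.reg 6 (by decide)).trans (Cmd.run_reg _ (by decide) _)).trans h6
    by_cases hc : t.reg 14 + 1 - B = 0
    · simp only [Cmd.run, Expr.eval_sub, Expr.eval_add, Expr.eval_reg, Expr.eval_ofNat, h6', hc,
        if_true]
      simp only [State.setReg_reg, Nat.reduceEqDiff, if_false]
      omega
    · simp only [Cmd.run, Expr.eval_sub, Expr.eval_add, Expr.eval_reg, Expr.eval_ofNat, h6', hc,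
        if_false]
      simp only [State.setReg_reg, Nat.reduceEqDiff, if_false, if_true, Nat.mul_add, mul_one]
      omega

theorem run_decode {I : WMaxPInstance} {s : State} (h : Ready I s) {N : ℕ} (h20 : s.reg 20 = N)
    (hN : N ≤ s.reg 9) : ∀ i < I.need + 2 ^ I.need,
      (decode.run s).arr 3 i = N / I.base I.need ^ i % I.base I.need := by
  have hB : 0 < I.base I.need := by simp only [WMaxPInstance.base]; omega
  have key := Cmd.rep_induct (x := 21) (b := 8)
    (P := divide ;; store 3 (reg 21) (reg 14) ;; assign 14 (reg 13))
    (s := (assign 14 (reg 20)).run s)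
    (fun j t => t.reg 14 = N / I.base I.need ^ j ∧
      ∀ i < j, t.arr 3 i = N / I.base I.need ^ i % I.base I.need) ?_ ?_
  · have h8 : ((assign 14 (reg 20)).run s).reg 8 = s.reg 8 := Cmd.run_reg _ (by decide) _
    rw [h8, h.digits] at key
    exact key.2
  · simp [Cmd.run, h20]
  · rintro j t hj hx hf ⟨h1, h2⟩
    have hR : Ready I t := (h.run (assign 14 (reg 20)) (by decide) (by decide)).of_frame hf
      (by decide) (by decide)
    have h9 : t.reg 9 = s.reg 9 := hR.codes.trans h.codes.symm
    obtain ⟨d1, d2⟩ := run_divide hB hR.base h1 ((Nat.div_le_self _ _).trans (hN.trans h9.ge))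
    have d3 : (divide.run t).reg 21 = j := (Cmd.run_reg _ (by decide) _).trans hx
    have d4 : (divide.run t).arr 3 = t.arr 3 := Cmd.run_arr _ (by decide) _
    refine ⟨?_, fun i hi => ?_⟩
    · simp [Cmd.run, d2, pow_succ, Nat.div_div_eq_div_mul]
    · rcases Nat.lt_succ_iff_lt_or_eq.mp hi with hi | rfl
      · simp [Cmd.run, d3, d4, hi.ne, h2 i hi]
      · simp [Cmd.run, d3, d1]

/-- A digit may exceed the number of bits of a voter, where the halving stops; by then the voter
number has become 0, so the result is the same. -/
theorem run_shift {I : WMaxPInstance} {s : State} (h : Ready I s) {v i : ℕ} (hv : v < I.n)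
    (h21 : s.reg 21 = v) (h22 : s.reg 22 = i) :
    (shift.run s).reg 14 = v / 2 ^ s.arr 3 i := by
  have key := Cmd.rep_induct (x := 23) (b := 5)
    (P := cond (get 3 (reg 22) - reg 23) (assign 14 (half (reg 14))))
    (s := (assign 14 (reg 21)).run s)
    (fun j t => t.reg 14 = v / 2 ^ min j (s.arr 3 i)) ?_ ?_
  · have h5 : ((assign 14 (reg 21)).run s).reg 5 = s.reg 5 := Cmd.run_reg _ (by decide) _
    rw [h5, h.bits] at key
    refine key.trans ?_
    rcases le_total (Nat.clog 2 I.n) (s.arr 3 i) with hle | hle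
    · have h1 := Nat.le_pow_clog one_lt_two I.n
      have h2 : 2 ^ Nat.clog 2 I.n ≤ 2 ^ s.arr 3 i := Nat.pow_le_pow_right two_pos hle
      rw [min_eq_left hle, Nat.div_eq_of_lt (by omega), Nat.div_eq_of_lt (by omega)]
    · rw [min_eq_right hle]
  · simp [Cmd.run, h21]
  · intro j t hj hx hf ih
    have e1 : t.reg 22 = i :=
      ((hf.reg 22 (by decide)).trans (Cmd.run_reg _ (by decide) _)).trans h22
    have e2 : t.arr 3 = s.arr 3 := (hf.arr 3 (by decide)).trans (Cmd.run_arr _ (by decide) _)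
    by_cases hc : s.arr 3 i - j = 0
    · have h1 : min j (s.arr 3 i) = min (j + 1) (s.arr 3 i) := by omega
      simp [Cmd.run, e1, e2, hx, hc, ih, h1]
    · have h1 : min j (s.arr 3 i) = j := by omega
      have h2 : min (j + 1) (s.arr 3 i) = j + 1 := by omega
      simp [Cmd.run, e1, e2, hx, hc, ih, h1, h2, pow_succ, Nat.div_div_eq_div_mul]

theorem run_pattern {I : WMaxPInstance} {s : State} (h : Ready I s) {v : ℕ} (hv : v < I.n)
    (h21 : s.reg 21 = v) : (pattern.run s).reg 13 = bitPattern (s.arr 3) v I.need := by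
  have key := Cmd.rep_induct (x := 22) (b := 4)
    (P := shift ;; assign 13 (reg 13 + reg 13 + (reg 14 - (half (reg 14) + half (reg 14)))))
    (s := (assign 13 0).run s)
    (fun j t => t.reg 13 = bitPattern (s.arr 3) v j) ?_ ?_
  · have h4 : ((assign 13 0).run s).reg 4 = s.reg 4 := Cmd.run_reg _ (by decide) _
    rw [h4, h.need] at key
    exact key
  · simp [Cmd.run, bitPattern]
  · intro j t hj hx hf ih
    have hR : Ready I t := (h.run (assign 13 0) (by decide) (by decide)).of_frame hf
      (by decide) (by decide)
    have e1 : t.reg 21 = v :=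
      ((hf.reg 21 (by decide)).trans (Cmd.run_reg _ (by decide) _)).trans h21
    have e2 : t.arr 3 = s.arr 3 := (hf.arr 3 (by decide)).trans (Cmd.run_arr _ (by decide) _)
    have e3 := run_shift hR hv e1 hx
    have e4 : (shift.run t).reg 13 = t.reg 13 := Cmd.run_reg _ (by decide) _
    simp only [Cmd.run, Expr.eval_add, Expr.eval_sub, Expr.eval_half, Expr.eval_reg,
      State.setReg_reg, e3, e4, e2, ih, bitPattern, bitAt, Nat.reduceEqDiff, if_false, if_true]
    omega

/-- The colouring with a given code. -/
noncomputable def colouring (I : WMaxPInstance) (N v : ℕ) : ℕ :=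
  N / I.base I.need ^ (I.need + bitPattern (fun i => N / I.base I.need ^ i % I.base I.need) v I.need)
    % I.base I.need

theorem run_colour {I : WMaxPInstance} {s : State} (h : Ready I s) {N : ℕ}
    (h3 : ∀ i < I.need + 2 ^ I.need, s.arr 3 i = N / I.base I.need ^ i % I.base I.need) :
    ∀ v < I.n, (colour.run s).arr 4 v = colouring I N v := by
  have key := Cmd.rep_induct (x := 21) (b := 1)
    (P := pattern ;; store 4 (reg 21) (get 3 (reg 4 + reg 13))) (s := s)
    (fun j t => ∀ v < j, t.arr 4 v = colouring I N v) (by simp) ?_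
  · rw [h.n] at key
    exact key
  · intro j t hj hx hf ih v hv
    rw [h.n] at hj
    have hR : Ready I t := h.of_frame hf (by decide) (by decide)
    have e1 := run_pattern hR hj hx
    have e2 : t.arr 3 = s.arr 3 := hf.arr 3 (by decide)
    have e3 : (pattern.run t).arr 3 = s.arr 3 := (Cmd.run_arr _ (by decide) _).trans e2
    have e4 : (pattern.run t).arr 4 = t.arr 4 := Cmd.run_arr _ (by decide) _
    have e5 : (pattern.run t).reg 21 = j := (Cmd.run_reg _ (by decide) _).trans hx
    have e6 : (pattern.run t).reg 4 = I.need := (hR.run _ (by decide) (by decide)).need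
    rcases Nat.lt_succ_iff_lt_or_eq.mp hv with hv | rfl
    · simp [Cmd.run, e4, e5, hv.ne, ih v hv]
    · have hlt := bitPattern_lt (s.arr 3) v I.need
      have hpat : bitPattern (s.arr 3) v I.need =
          bitPattern (fun i => N / I.base I.need ^ i % I.base I.need) v I.need :=
        bitPattern_congr (fun i hi => h3 i (by omega)) v
      simp only [Cmd.run, Expr.eval_add, Expr.eval_get, Expr.eval_reg, State.setReg_arr,
        State.setArr_arr, e1, e2, e3, e5, e6, and_self, if_true]
      rw [h3 _ (by omega), hpat, colouring]

/-! ### Layout, invariants and initialization of the table -/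

/-- The place of an entry of the table. -/
def place (r v a c : ℕ) : ℕ := v * ((r + 1) * (r + 1)) + a * (r + 1) + c

theorem place_inj {r v a c v' a' c' : ℕ} (ha : a ≤ r) (hc : c ≤ r) (ha' : a' ≤ r) (hc' : c' ≤ r)
    (h : place r v a c = place r v' a' c') : v = v' ∧ a = a' ∧ c = c' := by
  have h' : (v * (r + 1) + a) * (r + 1) + c = (v' * (r + 1) + a') * (r + 1) + c' := by
    simp only [place] at h; linarith
  have key : ∀ {x x' y y' : ℕ}, y ≤ r → y' ≤ r → x * (r + 1) + y = x' * (r + 1) + y' →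
      x = x' ∧ y = y' := by
    intro x x' y y' hy hy' h
    have e : x = x' := by
      rcases lt_trichotomy x x' with hlt | rfl | hlt
      · exfalso; nlinarith
      · rfl
      · exfalso; nlinarith
    subst e
    exact ⟨rfl, by omega⟩
  obtain ⟨h1, h2⟩ := key hc hc' h'
  obtain ⟨h3, h4⟩ := key ha ha' h1
  exact ⟨h3, h4, h2⟩

theorem eval_cell {I : WMaxPInstance} {s : State} (h : Ready I s) {e₁ e₂ e₃ : Expr} {v a c : ℕ}
    (hv : v < I.n) (ha : a ≤ I.need) (h₁ : e₁.eval s = v) (h₂ : e₂.eval s = a)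
    (h₃ : e₃.eval s = c) : (cell e₁ e₂ e₃).eval s = place I.need v a c := by
  have h1 := h.plane ⟨v, hv⟩
  have h2 := h.line a ha
  simp only at h1
  simp [cell, place, h₁, h₂, h₃, h1, h2]

/-- The table entry of `s` for `v`, `a` and `c`. -/
noncomputable def entry (I : WMaxPInstance) (s : State) (v a c : ℕ) : ℕ :=
  s.arr 5 (place I.need v a c)

/-- All small entries of the table are justified. -/
def Sound (I : WMaxPInstance) (col : Fin I.n → ℕ) (s : State) : Prop :=
  ∀ v : Fin I.n, ∀ a ≤ I.need, ∀ c ≤ I.need, entry I s v a c < I.cap →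
    Sem I.E.D I.E.d I.E.ω (subtree I.E.d I.target) col v a c (entry I s v a c)

/-- The entries only decrease. -/
def Decreases (s t : State) : Prop := ∀ i, t.arr 5 i ≤ s.arr 5 i

theorem Decreases.refl (s : State) : Decreases s s := fun _ => le_rfl

theorem Decreases.trans (s t u : State) (h : Decreases s t) (h' : Decreases t u) :
    Decreases s u := fun i => (h' i).trans (h i)

theorem Decreases.setArr {s : State} {i x : ℕ} (h : x ≤ s.arr 5 i) :
    Decreases s (s.setArr 5 i x) := by
  intro j
  simp only [State.setArr_arr, true_and]
  split_ifs with hj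
  · rwa [hj]
  · exact le_rfl

theorem Sound.setArr {I : WMaxPInstance} {col : Fin I.n → ℕ} {s : State} (h : Sound I col s)
    {v : Fin I.n} {a c x : ℕ} (ha : a ≤ I.need) (hc : c ≤ I.need)
    (hx : x < I.cap → Sem I.E.D I.E.d I.E.ω (subtree I.E.d I.target) col v a c x) :
    Sound I col (s.setArr 5 (place I.need v a c) x) := by
  intro v' a' ha' c' hc'
  simp only [entry, State.setArr_arr, true_and]
  split_ifs with heq
  · obtain ⟨h1, rfl, rfl⟩ := place_inj ha' hc' ha hc heq
    obtain rfl := Fin.ext h1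
    exact hx
  · exact h v' a' ha' c' hc'

theorem run_fill {I : WMaxPInstance} {s : State} (h : Ready I s) (v : ℕ) (hv : v < I.n) (a : ℕ)
    (ha : a ≤ I.need) (c : ℕ) (hc : c ≤ I.need) : entry I (fill.run s) v a c = I.cap := by
  let R : State → State → Prop := fun t t' => ∀ i, t.arr 5 i = I.cap → t'.arr 5 i = I.cap
  have refl : ∀ t, R t t := fun _ _ h => h
  have trans : ∀ t₁ t₂ t₃, R t₁ t₂ → R t₂ t₃ → R t₁ t₃ := fun _ _ _ h h' i hi => h' i (h i hi)
  have key := Cmd.rep_collect (x := 21) (b := 1)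
    (P := rep 22 10 (rep 23 10 (store 5 (cell (reg 21) (reg 22) (reg 23)) (reg 3)))) (s := s)
    (G := fun _ => True) (R := R)
    (Q := fun v _ t => ∀ a ≤ I.need, ∀ c ≤ I.need, entry I t v a c = I.cap) refl trans
    (fun _ _ _ _ _ _ h h' a ha c hc => h' _ (h a ha c hc)) (fun _ _ _ => trivial)
    (fun _ _ _ h => h) trivial ?_
  · rw [h.n] at key
    exact key.2.2 v hv a ha c hc
  intro v t hv hx hf _
  rw [h.n] at hv
  have h1 := h.of_frame hf (by decide) (by decide)
  have key := Cmd.rep_collect (x := 22) (b := 10)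
    (P := rep 23 10 (store 5 (cell (reg 21) (reg 22) (reg 23)) (reg 3))) (s := t)
    (G := fun _ => True) (R := R)
    (Q := fun a _ t => ∀ c ≤ I.need, entry I t v a c = I.cap) refl trans
    (fun _ _ _ _ _ _ h h' c hc => h' _ (h c hc)) (fun _ _ _ => trivial)
    (fun _ _ _ h => h) trivial ?_
  · rw [h1.width] at key
    exact ⟨trivial, key.2.1, fun a ha => key.2.2 a (by omega)⟩
  intro a t' ha hx' hf' _
  rw [h1.width] at ha
  have h2 := h1.of_frame hf' (by decide) (by decide)
  have x1 : t'.reg 21 = v := (hf'.reg 21 (by decide)).trans hx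
  have key := Cmd.rep_collect (x := 23) (b := 10)
    (P := store 5 (cell (reg 21) (reg 22) (reg 23)) (reg 3)) (s := t')
    (G := fun _ => True) (R := R)
    (Q := fun c _ t => entry I t v a c = I.cap) refl trans
    (fun _ _ _ _ _ _ h h' => h' _ h) (fun _ _ _ => trivial)
    (fun _ _ _ h => h) trivial ?_
  · rw [h2.width] at key
    exact ⟨trivial, key.2.1, fun c hc => key.2.2 c (by omega)⟩
  intro c t'' hc hx'' hf'' _
  have h3 := h2.of_frame hf'' (by decide) (by decide)
  have x2 : t''.reg 21 = v := (hf''.reg 21 (by decide)).trans x1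
  have x3 : t''.reg 22 = a := (hf''.reg 22 (by decide)).trans hx'
  have hcell := eval_cell h3 (e₁ := reg 21) (e₂ := reg 22) (e₃ := reg 23) hv (by omega) x2 x3 hx''
  simp only [Cmd.run, hcell, Expr.eval_reg, h3.cap]
  refine ⟨trivial, fun i hi => ?_, ?_⟩
  · simp only [State.setArr_arr]
    split_ifs <;> simp [hi]
  · simp [entry]

/-- What the initialization of the entries for `v` and `a` achieves. -/
def Initialized (I : WMaxPInstance) (col : Fin I.n → ℕ) (s : State) (v : Fin I.n) (a : ℕ) : Prop :=
  entry I s v a a = 0 ∧ (v ∉ subtree I.E.d I.target → col v = a →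
    entry I s v a (min (a + I.E.ω v) I.need) = 0)

theorem Initialized.mono {I : WMaxPInstance} {col : Fin I.n → ℕ} {s t : State} {v : Fin I.n} {a : ℕ}
    (h : Initialized I col s v a) (hd : Decreases s t) : Initialized I col t v a :=
  ⟨Nat.le_zero.mp ((hd _).trans h.1.le), fun h1 h2 => Nat.le_zero.mp ((hd _).trans (h.2 h1 h2).le)⟩

theorem run_collect {I : WMaxPInstance} {s : State} (h : Ready I s) {v : Fin I.n} {a : ℕ}
    (h21 : s.reg 21 = v) (h22 : s.reg 22 = a) (ha : a ≤ I.need) :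
    (collect.run s).arr 5 =
      (s.setArr 5 (place I.need v a (min (a + I.E.ω v) I.need)) 0).arr 5 := by
  have h1 := eval_weightExpr h.input (e := reg 21) v h21
  set s₁ := (assign 13 (reg 22 + weightExpr (reg 21))).run s with hs₁
  set s₂ := (cond (reg 13 - reg 4) (assign 13 (reg 4))).run s₁ with hs₂
  have r₁ : Ready I s₁ := h.run _ (by decide) (by decide)
  have r₂ : Ready I s₂ := r₁.run _ (by decide) (by decide)
  have e₁ : s₁.reg 13 = a + I.E.ω v := by simp [hs₁, Cmd.run, h22, h1]
  have e₂ : s₂.reg 13 = min (a + I.E.ω v) I.need := by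
    by_cases hc : a + I.E.ω v - I.need = 0
    · simp only [hs₂, Cmd.run, Expr.eval_sub, Expr.eval_reg, e₁, r₁.need, hc, if_true]
      omega
    · simp only [hs₂, Cmd.run, Expr.eval_sub, Expr.eval_reg, e₁, r₁.need, hc, if_false,
        State.setReg_reg, if_true]
      omega
  have f₁ : s₂.reg 21 = v :=
    (Cmd.run_reg _ (by decide) _).trans ((Cmd.run_reg _ (by decide) _).trans h21)
  have f₂ : s₂.reg 22 = a :=
    (Cmd.run_reg _ (by decide) _).trans ((Cmd.run_reg _ (by decide) _).trans h22)
  have a₂ : s₂.arr 5 = s.arr 5 :=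
    (Cmd.run_arr _ (by decide) _).trans (Cmd.run_arr _ (by decide) _)
  have hcell := eval_cell r₂ (e₁ := reg 21) (e₂ := reg 22) (e₃ := reg 13) v.2 ha f₁ f₂ e₂
  have : collect.run s = (store 5 (cell (reg 21) (reg 22) (reg 13)) 0).run s₂ := rfl
  rw [this]
  funext j
  simp [Cmd.run, hcell, a₂]

theorem run_initCell {I : WMaxPInstance} {col : Fin I.n → ℕ} {s : State} (h : Ready I s)
    (hcol : ∀ v : Fin I.n, s.arr 4 v = col v) (hs : Sound I col s) {v : Fin I.n} {a : ℕ}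
    (h21 : s.reg 21 = v) (h22 : s.reg 22 = a) (ha : a ≤ I.need) :
    Sound I col (initCell.run s) ∧ Decreases s (initCell.run s) ∧
      Initialized I col (initCell.run s) v a := by
  have hcell := eval_cell h (e₁ := reg 21) (e₂ := reg 22) (e₃ := reg 22) v.2 ha h21 h22 h22
  set s₁ := (store 5 (cell (reg 21) (reg 22) (reg 22)) 0).run s with hs₁
  have hs₁' : s₁ = s.setArr 5 (place I.need v a a) 0 := by simp [hs₁, Cmd.run, hcell]
  have r₁ : Ready I s₁ := h.run _ (by decide) (by decide)
  have S₁ : Sound I col s₁ := hs₁' ▸ hs.setArr ha ha fun _ => Sem.refl v a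
  have D₁ : Decreases s s₁ := hs₁' ▸ Decreases.setArr (Nat.zero_le _)
  have E₁ : entry I s₁ v a a = 0 := by simp [hs₁', entry]
  have e21 : s₁.reg 21 = v := by simp [hs₁', h21]
  have e22 : s₁.reg 22 = a := by simp [hs₁', h22]
  have e4 : s₁.arr 4 v = col v := by simp [hs₁', hcol]
  have hrun : initCell.run s =
      (cond (1 - get 2 (reg 21)) (cond (1 - neExpr (get 4 (reg 21)) (reg 22)) collect)).run s₁ := rfl
  rw [hrun]
  have hm := r₁.mark v
  by_cases hv : v ∈ subtree I.E.d I.target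
  · have h0 : (1 - get 2 (reg 21) : Expr).eval s₁ = 0 := by
      have := hm.mpr hv
      simp only [Expr.eval_sub, Expr.eval_ofNat, Expr.eval_get, Expr.eval_reg, e21]
      omega
    simp only [Cmd.run, h0, if_true]
    exact ⟨S₁, D₁, E₁, fun h => absurd hv h⟩
  have h1 : (1 - get 2 (reg 21) : Expr).eval s₁ ≠ 0 := by
    have := hm.not.mpr hv
    simp only [Expr.eval_sub, Expr.eval_ofNat, Expr.eval_get, Expr.eval_reg, e21]
    omega
  have hne := eval_neExpr (get 4 (reg 21)) (reg 22) s₁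
  simp only [Expr.eval_get, Expr.eval_reg, e21, e22, e4] at hne
  by_cases hc : col v = a
  · have h2 : (1 - neExpr (get 4 (reg 21)) (reg 22) : Expr).eval s₁ ≠ 0 := by
      simp [hne.mpr hc]
    simp only [Cmd.run, h1, h2, if_false]
    have harr := run_collect r₁ e21 e22 ha
    set s₂ := s₁.setArr 5 (place I.need v a (min (a + I.E.ω v) I.need)) 0 with hs₂
    have S₂ : Sound I col s₂ := S₁.setArr ha (min_le_right _ _) fun _ =>
      Sem.own hv hc (by omega) (by omega)
    have D₂ : Decreases s₁ s₂ := Decreases.setArr (Nat.zero_le _)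
    have I₂ : Initialized I col s₂ v a :=
      ⟨Nat.le_zero.mp ((D₂ _).trans E₁.le), fun _ _ => by simp [hs₂, entry]⟩
    refine ⟨fun v' a' ha' c' hc' => ?_, fun i => ?_, ?_⟩
    · have := S₂ v' a' ha' c' hc'
      simpa only [entry, harr] using this
    · rw [harr]
      exact Decreases.trans _ _ _ D₁ D₂ i
    · simpa only [Initialized, entry, harr] using I₂
  · have h2 : (1 - neExpr (get 4 (reg 21)) (reg 22) : Expr).eval s₁ = 0 := by
      have := hne.not.mpr hc
      simp only [Expr.eval_sub, Expr.eval_ofNat]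
      omega
    simp only [Cmd.run, h1, h2, if_false, if_true]
    exact ⟨S₁, D₁, E₁, fun _ h => absurd h hc⟩

theorem run_init {I : WMaxPInstance} {col : Fin I.n → ℕ} {s : State} (h : Ready I s)
    (hcol : ∀ v : Fin I.n, s.arr 4 v = col v) (hs : Sound I col s) :
    Sound I col (init.run s) ∧
      ∀ v : Fin I.n, ∀ a ≤ I.need, Initialized I col (init.run s) v a := by
  have key := Cmd.rep_collect (x := 21) (b := 1) (P := rep 22 10 initCell) (s := s)
    (G := Sound I col) (R := Decreases)
    (Q := fun i _ t => ∀ v : Fin I.n, v = i → ∀ a ≤ I.need, Initialized I col t v a)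
    Decreases.refl Decreases.trans
    (fun _ _ _ _ _ _ h h' v hv a ha => (h v hv a ha).mono h') (fun _ _ h => h)
    (fun _ _ _ => le_rfl) hs ?_
  · rw [h.n] at key
    exact ⟨key.1, fun v => key.2.2 v v.2 v rfl⟩
  intro i t hi hx hf hst
  rw [h.n] at hi
  have h1 := h.of_frame hf (by decide) (by decide)
  have hcol1 : t.arr 4 = s.arr 4 := hf.arr 4 (by decide)
  have key := Cmd.rep_collect (x := 22) (b := 10) (P := initCell) (s := t)
    (G := Sound I col) (R := Decreases)
    (Q := fun a _ t => Initialized I col t ⟨i, hi⟩ a)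
    Decreases.refl Decreases.trans
    (fun _ _ _ _ _ _ h h' => h.mono h') (fun _ _ h => h)
    (fun _ _ _ => le_rfl) hst ?_
  · rw [h1.width] at key
    refine ⟨key.1, key.2.1, ?_⟩
    rintro v rfl a ha
    exact key.2.2 a (by omega)
  intro a t' ha hx' hf' hst'
  rw [h1.width] at ha
  have h2 := h1.of_frame hf' (by decide) (by decide)
  have hcol2 : t'.arr 4 = s.arr 4 := (hf'.arr 4 (by decide)).trans hcol1
  exact run_initCell h2 (fun v => by rw [hcol2, hcol]) hst' (v := ⟨i, hi⟩)
    ((hf'.reg 21 (by decide)).trans hx) hx' (by omega)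

/-! ### Relaxation of the table -/

theorem run_relaxCell {I : WMaxPInstance} {col : Fin I.n → ℕ} {s : State} (h : Ready I s)
    (hs : Sound I col s) {u v : Fin I.n} {a b c p : ℕ} (h22 : s.reg 22 = u) (h23 : s.reg 23 = v)
    (h24 : s.reg 24 = a) (h25 : s.reg 25 = b) (h26 : s.reg 26 = c) (h14 : s.reg 14 = p)
    (ha : a ≤ I.need) (hb : b ≤ I.need) (hc : c ≤ I.need) (hl : Link I.E.D I.E.d u v)
    (hp : price I.E.d u v ≤ p) :
    Sound I col (relaxCell.run s) ∧ Decreases s (relaxCell.run s) ∧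
      entry I (relaxCell.run s) v a c ≤ entry I s v a b + entry I s u b c + p := by
  have c1 := eval_cell h (e₁ := reg 23) (e₂ := reg 24) (e₃ := reg 25) v.2 ha h23 h24 h25
  have c2 := eval_cell h (e₁ := reg 22) (e₂ := reg 25) (e₃ := reg 26) u.2 hb h22 h25 h26
  set s₁ := (assign 15 (get 5 (cell (reg 23) (reg 24) (reg 25)) +
    get 5 (cell (reg 22) (reg 25) (reg 26)) + reg 14)).run s with hs₁
  have hs₁' : s₁ = s.setReg 15 (entry I s v a b + entry I s u b c + p) := by
    simp [hs₁, Cmd.run, c1, c2, entry, h14]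
  have r₁ : Ready I s₁ := h.run _ (by decide) (by decide)
  have c3 := eval_cell r₁ (e₁ := reg 23) (e₂ := reg 24) (e₃ := reg 26) (v := v) (a := a) (c := c)
    v.2 ha (by simp [hs₁', h23]) (by simp [hs₁', h24]) (by simp [hs₁', h26])
  have e15 : s₁.reg 15 = entry I s v a b + entry I s u b c + p := by simp [hs₁']
  have e5 : s₁.arr 5 (place I.need v a c) = entry I s v a c := by simp [hs₁', entry]
  have S₁ : Sound I col s₁ := by rw [hs₁']; exact hs
  have D₁ : Decreases s s₁ := by rw [hs₁']; exact fun _ => le_rfl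
  have hrun : relaxCell.run s = (cond (get 5 (cell (reg 23) (reg 24) (reg 26)) - reg 15)
    (store 5 (cell (reg 23) (reg 24) (reg 26)) (reg 15))).run s₁ := rfl
  rw [hrun]
  simp only [Cmd.run, Expr.eval_sub, Expr.eval_get, Expr.eval_reg, c3, e15, e5]
  split_ifs with hcmp
  · refine ⟨S₁, D₁, ?_⟩
    have : entry I s₁ v a c = entry I s v a c := e5
    omega
  · refine ⟨S₁.setArr ha hc fun hlt => ?_, Decreases.trans _ _ _ D₁ (Decreases.setArr ?_), ?_⟩
    -- If the sum is below `cap`, so are its summands; hence soundness applies to both, and `cap`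
    -- can serve as infinity.
    · exact ((hs v a ha b hb (by omega)).attach (hs u b hb c hc (by omega)) hl).mono (by omega)
    · rw [e5]; omega
    · simp [entry]

/-- The table `t` is relaxed along `(u, v)` with price `p` with respect to the table `s`. -/
def Relaxed (I : WMaxPInstance) (u v p : ℕ) (s t : State) : Prop :=
  ∀ a ≤ I.need, ∀ b ≤ I.need, ∀ c ≤ I.need,
    entry I t v a c ≤ entry I s v a b + entry I s u b c + p

theorem Relaxed.mono {I : WMaxPInstance} {u v p : ℕ} {t₀ t₁ t₂ t₃ : State} (h : Decreases t₀ t₁)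
    (h' : Relaxed I u v p t₁ t₂) (h'' : Decreases t₂ t₃) : Relaxed I u v p t₀ t₃ :=
  fun a ha b hb c hc => (h'' _).trans ((h' a ha b hb c hc).trans
    (Nat.add_le_add_right (Nat.add_le_add (h _) (h _)) p))

/-- The table is updated in place, so the values read may already be smaller than those of `s`. This
only strengthens the bound. -/
theorem run_relaxArc {I : WMaxPInstance} {col : Fin I.n → ℕ} {s : State} (h : Ready I s)
    (hs : Sound I col s) {u v : Fin I.n} {p : ℕ} (h22 : s.reg 22 = u) (h23 : s.reg 23 = v)
    (h14 : s.reg 14 = p) (hl : Link I.E.D I.E.d u v) (hp : price I.E.d u v ≤ p) :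
    Sound I col (relaxArc.run s) ∧ Decreases s (relaxArc.run s) ∧
      Relaxed I u v p s (relaxArc.run s) := by
  have key := Cmd.rep_collect (x := 24) (b := 10) (P := rep 25 10 (rep 26 10 relaxCell)) (s := s)
    (G := Sound I col) (R := Decreases)
    (Q := fun a s t => ∀ b ≤ I.need, ∀ c ≤ I.need,
      entry I t v a c ≤ entry I s v a b + entry I s u b c + p)
    Decreases.refl Decreases.trans
    (fun _ _ _ _ _ h h' h'' b hb c hc => (h'' _).trans ((h' b hb c hc).trans
      (Nat.add_le_add_right (Nat.add_le_add (h _) (h _)) p)))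
    (fun _ _ h => h) (fun _ _ _ => le_rfl) hs ?_
  · rw [h.width] at key
    exact ⟨key.1, key.2.1, fun a ha => key.2.2 a (by omega)⟩
  intro a t₁ ha hx₁ hf₁ hs₁
  rw [h.width] at ha
  have h₁ := h.of_frame hf₁ (by decide) (by decide)
  have key := Cmd.rep_collect (x := 25) (b := 10) (P := rep 26 10 relaxCell) (s := t₁)
    (G := Sound I col) (R := Decreases)
    (Q := fun b s t => ∀ c ≤ I.need, entry I t v a c ≤ entry I s v a b + entry I s u b c + p)
    Decreases.refl Decreases.trans
    (fun _ _ _ _ _ h h' h'' c hc => (h'' _).trans ((h' c hc).trans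
      (Nat.add_le_add_right (Nat.add_le_add (h _) (h _)) p)))
    (fun _ _ h => h) (fun _ _ _ => le_rfl) hs₁ ?_
  · rw [h₁.width] at key
    exact ⟨key.1, key.2.1, fun b hb => key.2.2 b (by omega)⟩
  intro b t₂ hb hx₂ hf₂ hs₂
  rw [h₁.width] at hb
  have h₂ := h₁.of_frame hf₂ (by decide) (by decide)
  have key := Cmd.rep_collect (x := 26) (b := 10) (P := relaxCell) (s := t₂)
    (G := Sound I col) (R := Decreases)
    (Q := fun c s t => entry I t v a c ≤ entry I s v a b + entry I s u b c + p)
    Decreases.refl Decreases.trans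
    (fun _ _ _ _ _ h h' h'' => (h'' _).trans (h'.trans
      (Nat.add_le_add_right (Nat.add_le_add (h _) (h _)) p)))
    (fun _ _ h => h) (fun _ _ _ => le_rfl) hs₂ ?_
  · rw [h₂.width] at key
    exact ⟨key.1, key.2.1, fun c hc => key.2.2 c (by omega)⟩
  intro c t₃ hc hx₃ hf₃ hs₃
  rw [h₂.width] at hc
  have h₃ := h₂.of_frame hf₃ (by decide) (by decide)
  have fr : ∀ x ∈ [14, 22, 23], t₃.reg x = s.reg x := fun x hx =>
    (hf₃.reg x (by fin_cases hx <;> decide)).trans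
      ((hf₂.reg x (by fin_cases hx <;> decide)).trans (hf₁.reg x (by fin_cases hx <;> decide)))
  exact run_relaxCell h₃ hs₃ ((fr 22 (by decide)).trans h22) ((fr 23 (by decide)).trans h23)
    ((hf₃.reg 24 (by decide)).trans ((hf₂.reg 24 (by decide)).trans hx₁))
    ((hf₃.reg 25 (by decide)).trans hx₂) hx₃ ((fr 14 (by decide)).trans h14)
    (by omega) (by omega) (by omega) hl hp

/-- If `u` delegates to `v` and the digraph has this arc as well, both relaxations take place. The
one at price 1 is sound since `run_relaxArc` only asks for a price that is not too low. -/
theorem run_relaxPair {I : WMaxPInstance} {col : Fin I.n → ℕ} {s : State} (h : Ready I s)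
    (hs : Sound I col s) {u v : Fin I.n} (h22 : s.reg 22 = u) (h23 : s.reg 23 = v) :
    Sound I col (relaxPair.run s) ∧ Decreases s (relaxPair.run s) ∧
      (Link I.E.D I.E.d u v → Relaxed I u v (price I.E.d u v) s (relaxPair.run s)) := by
  have hadj := eval_adjExpr h.toLoaded (e₁ := reg 22) (e₂ := reg 23) u v h22 h23 (h.row u)
  set s₁ := (cond (adjExpr (reg 22) (reg 23)) (assign 14 1 ;; relaxArc)).run s with hs₁
  have r₁ : Ready I s₁ := h.run _ (by decide) (by decide)
  have e22 : s₁.reg 22 = u := (Cmd.run_reg _ (by decide) _).trans h22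
  have e23 : s₁.reg 23 = v := (Cmd.run_reg _ (by decide) _).trans h23
  have first : Sound I col s₁ ∧ Decreases s s₁ ∧ (I.E.D.Adj u v → Relaxed I u v 1 s s₁) := by
    by_cases hA : I.E.D.Adj u v
    · simp only [hs₁, Cmd.run, hadj.mpr hA, if_false]
      have r : Ready I ((assign 14 1).run s) := h.run _ (by decide) (by decide)
      obtain ⟨h1, h2, h3⟩ := run_relaxArc (s := (assign 14 1).run s) (p := 1) r hs
        ((Cmd.run_reg _ (by decide) _).trans h22) ((Cmd.run_reg _ (by decide) _).trans h23)
        (by simp [Cmd.run]) (.inr hA) (by simp only [price]; split_ifs <;> omega)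
      exact ⟨h1, h2, fun _ => h3⟩
    · have h0 : (adjExpr (reg 22) (reg 23)).eval s = 0 := not_not.mp (hadj.not.mpr hA)
      simp only [hs₁, Cmd.run, h0, if_true]
      exact ⟨hs, .refl _, fun h => absurd h hA⟩
  obtain ⟨S₁, D₁, R₁⟩ := first
  have hrun : relaxPair.run s = (Cmd.cond (1 - neExpr (delegateExpr (reg 22)) (reg 23))
    (assign 14 0 ;; relaxArc)).run s₁ := rfl
  rw [hrun]
  have hd := eval_delegateExpr r₁.toLoaded (e := reg 22) u e22
  have hne := eval_neExpr (delegateExpr (reg 22)) (reg 23) s₁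
  rw [hd, Expr.eval_reg, e23, ← Fin.ext_iff] at hne
  by_cases hc : I.E.d u = v
  · have h0 : (1 - neExpr (delegateExpr (reg 22)) (reg 23) : Expr).eval s₁ ≠ 0 := by
      simp [hne.mpr hc]
    simp only [Cmd.run, h0, if_false]
    have r : Ready I ((assign 14 0).run s₁) := r₁.run _ (by decide) (by decide)
    obtain ⟨h1, h2, h3⟩ := run_relaxArc (s := (assign 14 0).run s₁) (p := 0) r S₁
      ((Cmd.run_reg _ (by decide) _).trans e22) ((Cmd.run_reg _ (by decide) _).trans e23)
      (by simp [Cmd.run]) (.inl hc) (by simp [price, hc])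
    have h2' : Decreases s₁ _ := h2
    refine ⟨h1, D₁.trans _ _ _ h2', fun _ => ?_⟩
    rw [price, if_pos hc]
    exact Relaxed.mono D₁ h3 (.refl _)
  · have h0 : (1 - neExpr (delegateExpr (reg 22)) (reg 23) : Expr).eval s₁ = 0 := by
      have := hne.not.mpr hc
      simp only [Expr.eval_sub, Expr.eval_ofNat]
      omega
    simp only [Cmd.run, h0, if_true]
    refine ⟨S₁, D₁, fun hl => ?_⟩
    rw [price, if_neg hc]
    exact R₁ (hl.resolve_left hc)

theorem run_round {I : WMaxPInstance} {col : Fin I.n → ℕ} {s : State} (h : Ready I s)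
    (hs : Sound I col s) :
    Sound I col (round.run s) ∧ Decreases s (round.run s) ∧
      ∀ u v : Fin I.n, Link I.E.D I.E.d u v →
        Relaxed I u v (price I.E.d u v) s (round.run s) := by
  have key := Cmd.rep_collect (x := 22) (b := 1) (P := rep 23 1 relaxPair) (s := s)
    (G := Sound I col) (R := Decreases)
    (Q := fun i s t => ∀ u v : Fin I.n, u = i → Link I.E.D I.E.d u v →
      Relaxed I u v (price I.E.d u v) s t)
    Decreases.refl Decreases.trans
    (fun _ _ _ _ _ h h' h'' u v hu hl => Relaxed.mono h (h' u v hu hl) h'')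
    (fun _ _ h => h) (fun _ _ _ => le_rfl) hs ?_
  · rw [h.n] at key
    exact ⟨key.1, key.2.1, fun u v => key.2.2 u u.2 u v rfl⟩
  intro i t hi hx hf hst
  rw [h.n] at hi
  have h₁ := h.of_frame hf (by decide) (by decide)
  have key := Cmd.rep_collect (x := 23) (b := 1) (P := relaxPair) (s := t)
    (G := Sound I col) (R := Decreases)
    (Q := fun j s t => ∀ v : Fin I.n, v = j → Link I.E.D I.E.d ⟨i, hi⟩ v →
      Relaxed I i v (price I.E.d ⟨i, hi⟩ v) s t)
    Decreases.refl Decreases.trans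
    (fun _ _ _ _ _ h h' h'' v hv hl => Relaxed.mono h (h' v hv hl) h'')
    (fun _ _ h => h) (fun _ _ _ => le_rfl) hst ?_
  · rw [h₁.n] at key
    refine ⟨key.1, key.2.1, ?_⟩
    rintro u v rfl
    exact key.2.2 v v.2 v rfl
  intro j t' hj hx' hf' hst'
  rw [h₁.n] at hj
  obtain ⟨h1, h2, h3⟩ := run_relaxPair (h₁.of_frame hf' (by decide) (by decide)) hst'
    (u := ⟨i, hi⟩) (v := ⟨j, hj⟩) ((hf'.reg 22 (by decide)).trans hx) hx'
  refine ⟨h1, h2, ?_⟩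
  rintro v rfl
  exact h3

/-- After `i` rounds the table accounts for all coloured in-trees with at most `i` arcs: the two
parts of an `attach` have fewer arcs than the whole, and the next round joins them. The trees that
matter have fewer than `n` arcs. -/
theorem run_rounds {I : WMaxPInstance} {col : Fin I.n → ℕ} {s : State} (h : Ready I s)
    (hs : Sound I col s) (hi : ∀ v : Fin I.n, ∀ a ≤ I.need, Initialized I col s v a) :
    Sound I col (rounds.run s) ∧ ∀ v X j t, Der I.E.D I.E.d v X j t → t < I.n → ∀ a,
      Coloured I.E.ω (subtree I.E.d I.target) col I.need a X →
        entry I (rounds.run s) v (min a I.need) (min (a + (X.map I.E.ω).sum) I.need) ≤ j := by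
  have key := Cmd.rep_induct (x := 21) (b := 1) (P := round) (s := s)
    (fun i t => Sound I col t ∧ ∀ v X j m, Der I.E.D I.E.d v X j m → m ≤ i → ∀ a,
      Coloured I.E.ω (subtree I.E.d I.target) col I.need a X →
        entry I t v (min a I.need) (min (a + (X.map I.E.ω).sum) I.need) ≤ j) ?_ ?_
  · rw [h.n] at key
    exact ⟨key.1, fun v X j t hder ht => key.2 v X j t hder ht.le⟩
  · refine ⟨hs, fun v X j m hder hm a hX => ?_⟩
    cases hder with
    | nil => simpa [entry] using (hi v _ (min_le_right a I.need)).1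
    | own =>
      obtain ⟨hv, hc, -⟩ := hX
      have h1 := (hi v _ (min_le_right a I.need)).2 hv hc
      -- Cutting off partial sums early does not change the cut-off total.
      have h2 : min (min a I.need + I.E.ω v) I.need = min (a + I.E.ω v) I.need := by omega
      rw [h2] at h1
      simpa [entry] using h1.le
    | attach => omega
  · rintro i t hi' hx hf ⟨h1, h2⟩
    obtain ⟨g1, g2, g3⟩ := run_round (h.of_frame hf (by decide) (by decide)) h1
    refine ⟨g1, fun v X j m hder hm a hX => ?_⟩
    cases hder with
    | nil => exact (g2 _).trans (h2 _ _ _ _ (.nil v) (by omega) a hX)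
    | own => exact (g2 _).trans (h2 _ _ _ _ (.own v) (by omega) a hX)
    | @attach u _ X Y j j' m m' hd hd' hl =>
      rw [coloured_append] at hX
      have e1 := h2 _ _ _ _ hd (by omega) a hX.1
      have e2 := h2 _ _ _ _ hd' (by omega) _ hX.2
      have e3 := g3 u v hl (min a I.need) (min_le_right _ _)
        (min (a + (X.map I.E.ω).sum) I.need) (min_le_right _ _)
        (min (a + (X.map I.E.ω).sum + (Y.map I.E.ω).sum) I.need) (min_le_right _ _)
      rw [List.map_append, List.sum_append, ← add_assoc]
      refine e3.trans ?_
      omega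

/-! ### From one colouring to all codes -/

/-- One pass of the main loop sets the answer to `1` or keeps it. If it sets it, the answer is yes,
and it does if the code of the pass colours a solution. -/
theorem run_pass {I : WMaxPInstance} {s : State} (h : Ready I s) {N : ℕ} (h20 : s.reg 20 = N)
    (hN : N ≤ s.reg 9) :
    let t := (decode ;; colour ;; fill ;; init ;; rounds ;; accept).run s
    (t.reg 0 = s.reg 0 ∨ t.reg 0 = 1 ∧ I.IsYes) ∧
      ∀ X j m, Der I.E.D I.E.d I.target X j m → m < I.n → j < I.cap →
        I.need ≤ (X.map I.E.ω).sum →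
        Coloured I.E.ω (subtree I.E.d I.target) (fun v => colouring I N v) I.need 0 X →
          t.reg 0 = 1 := by
  intro t
  set s₁ := decode.run s with hs₁
  have r₁ : Ready I s₁ := h.run _ (by decide) (by decide)
  set s₂ := colour.run s₁ with hs₂
  have r₂ : Ready I s₂ := r₁.run _ (by decide) (by decide)
  have c₂ := run_colour r₁ (run_decode h h20 hN)
  rw [← hs₂] at c₂
  set s₃ := fill.run s₂ with hs₃
  have r₃ : Ready I s₃ := r₂.run _ (by decide) (by decide)
  have c₃ : s₃.arr 4 = s₂.arr 4 := Cmd.run_arr _ (by decide) _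
  -- All entries equal `cap` at this point, so soundness is vacuous.
  have S₃ : Sound I (fun v => colouring I N v) s₃ := fun v a ha c hc hlt => by
    rw [run_fill r₂ v v.2 a ha c hc] at hlt
    exact absurd hlt (lt_irrefl _)
  set s₄ := init.run s₃ with hs₄
  have r₄ : Ready I s₄ := r₃.run _ (by decide) (by decide)
  obtain ⟨S₄, I₄⟩ := run_init r₃ (fun v => by rw [c₃, c₂ v v.2]) S₃
  set s₅ := rounds.run s₄ with hs₅
  have r₅ : Ready I s₅ := r₄.run _ (by decide) (by decide)
  obtain ⟨S₅, C₅⟩ := run_rounds r₄ S₄ I₄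
  have e0 : s₅.reg 0 = s.reg 0 :=
    Cmd.run_reg (decode ;; colour ;; fill ;; init ;; rounds) (by decide) s
  have hcell := eval_cell r₅ (e₁ := reg 2) (e₂ := 0) (e₃ := reg 4) (c := I.need) I.target.2
    (Nat.zero_le _) r₅.target (by simp) r₅.need
  have hval : (reg 3 - get 5 (cell (reg 2) 0 (reg 4)) : Expr).eval s₅ =
      I.cap - entry I s₅ I.target 0 I.need := by
    simp only [Expr.eval_sub, Expr.eval_reg, Expr.eval_get, hcell, r₅.cap, entry]
  have ht : t = accept.run s₅ := rfl
  by_cases hc : entry I s₅ I.target 0 I.need < I.cap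
  · have h1 : t.reg 0 = 1 := by
      have : (reg 3 - get 5 (cell (reg 2) 0 (reg 4)) : Expr).eval s₅ ≠ 0 := by omega
      simp [ht, accept, Cmd.run, -Expr.eval_sub, this]
    exact ⟨.inr ⟨h1, WMaxPInstance.isYes_of_certified hc
      (S₅ I.target 0 (Nat.zero_le _) I.need le_rfl hc)⟩, fun _ _ _ _ _ _ _ _ => h1⟩
  · have h1 : t.reg 0 = s.reg 0 := by
      have : (reg 3 - get 5 (cell (reg 2) 0 (reg 4)) : Expr).eval s₅ = 0 := by omega
      simp [ht, accept, Cmd.run, -Expr.eval_sub, this, e0]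
    refine ⟨.inl h1, fun X j m hder hm hj hw hX => absurd ?_ hc⟩
    have := C₅ _ _ _ _ hder hm 0 hX
    rw [Nat.zero_min, zero_add, min_eq_right hw] at this
    exact this.trans_lt hj

/-- Colours matter only on the listed voters, of which there are at most `need`, so `exists_code`
realizes them. The base exceeds both the bit positions and the colours, so each of these fits into
one digit. -/
theorem exists_colouring {I : WMaxPInstance} (hτ : I.τ ≠ 0) (h : I.IsYes) :
    ∃ N < I.base I.need ^ (I.need + 2 ^ I.need), ∃ X j m,
      Der I.E.D I.E.d I.target X j m ∧ m < I.n ∧ j < I.cap ∧ I.need ≤ (X.map I.E.ω).sum ∧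
        Coloured I.E.ω (subtree I.E.d I.target) (fun v => colouring I N v) I.need 0 X := by
  obtain ⟨X, j, m, hX, hlen, hU, hj, hm, hw, hder⟩ := WMaxPInstance.exists_der_of_isYes hτ h
  obtain ⟨g, hg, hcol⟩ := exists_coloured I.E.ω I.need hX hU 0
  obtain ⟨N, hN, hNg⟩ := exists_code (L := Nat.clog 2 I.n) (r := I.need) (B := I.base I.need)
    (by simp only [WMaxPInstance.base]; omega) (X.toFinset.image Fin.val)
    (fun x hx => by
      obtain ⟨v, -, rfl⟩ := Finset.mem_image.mp hx
      exact v.2.trans_le (Nat.le_pow_clog one_lt_two _))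
    (Finset.card_image_le.trans ((List.toFinset_card_le X).trans hlen))
    (fun x => if hx : x < I.n then g ⟨x, hx⟩ else 0)
    (fun x => by
      have : ∀ v, g v < I.base I.need := fun v => (hg v).trans_lt (by
        simp only [WMaxPInstance.base]; omega)
      split_ifs
      · exact this _
      · simp only [WMaxPInstance.base]; omega)
  refine ⟨N, hN, X, j, m, hder, hm, hj, hw, hcol _ fun v hv => ?_⟩
  have := hNg v (Finset.mem_image_of_mem _ (List.mem_toFinset.mpr hv))
  simpa [colouring] using this

theorem run_mainLoop {I : WMaxPInstance} {s : State} (h : Ready I s)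
    (h0 : s.reg 0 = if I.τ = 0 then 1 else 0) :
    (I.IsYes → (mainLoop.run s).reg 0 = 1) ∧ (¬ I.IsYes → (mainLoop.run s).reg 0 = 0) := by
  have key := Cmd.rep_induct (x := 20) (b := 9)
    (P := decode ;; colour ;; fill ;; init ;; rounds ;; accept) (s := s)
    -- Either the answer is already justified, or no code tried so far colours a solution. Once all
    -- codes are tried, the latter contradicts a yes-instance.
    (fun i t => (t.reg 0 = 1 ∧ I.IsYes ∨ t.reg 0 = 0 ∧ I.τ ≠ 0 ∧ ∀ N < i, ∀ X j m,
      Der I.E.D I.E.d I.target X j m → m < I.n → j < I.cap → I.need ≤ (X.map I.E.ω).sum →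
        ¬ Coloured I.E.ω (subtree I.E.d I.target) (fun v => colouring I N v) I.need 0 X)) ?_ ?_
  · rw [h.codes] at key
    rcases key with ⟨h1, h2⟩ | ⟨h1, h2, h3⟩
    · exact ⟨fun _ => h1, fun h => absurd h2 h⟩
    · refine ⟨fun hyes => ?_, fun _ => h1⟩
      obtain ⟨N, hN, X, j, m, hder, hm, hj, hw, hX⟩ := exists_colouring h2 hyes
      exact absurd hX (h3 N hN X j m hder hm hj hw)
  · by_cases hτ : I.τ = 0
    · exact .inl ⟨by simp [h0, hτ], I.isYes_of_zero hτ⟩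
    · exact .inr ⟨by simp [h0, hτ], hτ, fun _ h => absurd h (Nat.not_lt_zero _)⟩
  · intro i t hi hx hf ih
    have hR := h.of_frame hf (by decide) (by decide)
    obtain ⟨h1, h2⟩ := run_pass hR hx (by rw [hR.codes, ← h.codes]; exact hi.le)
    simp only [State.setReg_reg, show (0 : ℕ) ≠ 20 by decide, if_false]
    rcases h1 with h1 | h1
    · rw [h1] at h2 ⊢
      refine ih.imp id fun ⟨g1, g2, g3⟩ => ⟨g1, g2, fun N hN X j m hd hm hj hw hX => ?_⟩
      rcases Nat.lt_succ_iff_lt_or_eq.mp hN with hN | rfl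
      · exact g3 N hN X j m hd hm hj hw hX
      · have := h2 X j m hd hm hj hw hX
        omega
    · exact .inl h1

/-! ### Running time -/

/-- The dependence of the loop bounds on the parameter. -/
def factor (r : ℕ) : ℕ := (r + 2 ^ r) ^ (r + 2 ^ r) * 2 ^ (r + 1 + (r + 2 ^ r)) * 2

theorem factor_mono : Monotone factor := by
  intro a b h
  have h1 : a + 2 ^ a ≤ b + 2 ^ b := add_le_add h (Nat.pow_le_pow_right two_pos h)
  have h2 : (a + 2 ^ a) ^ (a + 2 ^ a) ≤ (b + 2 ^ b) ^ (b + 2 ^ b) :=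
    (Nat.pow_le_pow_left h1 _).trans
      (Nat.pow_le_pow_right (by have := Nat.two_pow_pos b; omega) h1)
  have h3 : 2 ^ (a + 1 + (a + 2 ^ a)) ≤ 2 ^ (b + 1 + (b + 2 ^ b)) :=
    Nat.pow_le_pow_right two_pos (by omega)
  exact Nat.mul_le_mul_right 2 (Nat.mul_le_mul h2 h3)

theorem primrec_pow : Primrec₂ (fun a b : ℕ => a ^ b) := Primrec₂.unpaired'.mp Nat.Primrec.pow

theorem primrec_factor : Primrec factor := by
  have h2 : Primrec fun r : ℕ => r + 2 ^ r :=
    Primrec.nat_add.comp .id (primrec_pow.comp (.const 2) .id)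
  have h3 : Primrec fun r : ℕ => 2 ^ (r + 1 + (r + 2 ^ r)) :=
    primrec_pow.comp (.const 2) (Primrec.nat_add.comp Primrec.succ h2)
  exact Primrec.nat_mul.comp (Primrec.nat_mul.comp (primrec_pow.comp h2 h2) h3) (.const 2)

/-- The rising factorial of `B` dominates the power and is `m!` times a binomial coefficient. This
moves `B` into an exponent of two, where a logarithm becomes harmless. -/
theorem pow_le_factorial_mul (B m : ℕ) : B ^ m ≤ m.factorial * 2 ^ (B + m) := by
  refine (Nat.pow_succ_le_ascFactorial B m).trans ?_
  rw [Nat.ascFactorial_eq_factorial_mul_choose']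
  exact Nat.mul_le_mul_left _ ((Nat.choose_le_two_pow _ _).trans
    (Nat.pow_le_pow_right two_pos (Nat.sub_le _ _)))

theorem two_pow_clog_le {n : ℕ} (hn : 0 < n) : 2 ^ Nat.clog 2 n ≤ 2 * n := by
  rcases Nat.lt_or_ge 1 n with h | h
  · have h1 := Nat.pow_pred_clog_lt_self one_lt_two h
    have h2 := Nat.clog_pos one_lt_two h
    have h3 : Nat.clog 2 n = (Nat.clog 2 n).pred + 1 := by simp only [Nat.pred_eq_sub_one]; omega
    rw [h3, pow_succ]
    omega
  · rw [Nat.clog_of_right_le_one h]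
    omega

/-- The only dependence of the base on `n` is its logarithm, and `2 ^ Nat.clog 2 n ≤ 2 * n`. So `n`
enters linearly and the rest depends on `need` alone. -/
theorem codes_le (I : WMaxPInstance) :
    I.base I.need ^ (I.need + 2 ^ I.need) ≤ factor I.need * I.n := by
  have hn : 0 < I.n := (Nat.zero_le _).trans_lt I.target.2
  set r := I.need
  set m := r + 2 ^ r with hm
  refine (pow_le_factorial_mul _ _).trans ?_
  have h1 : 2 ^ (I.base r + m) = 2 ^ Nat.clog 2 I.n * 2 ^ (r + 1 + m) := by
    rw [← pow_add, WMaxPInstance.base, add_assoc]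
  rw [h1, factor, ← hm]
  calc m.factorial * (2 ^ Nat.clog 2 I.n * 2 ^ (r + 1 + m))
      ≤ m ^ m * (2 * I.n * 2 ^ (r + 1 + m)) :=
        Nat.mul_le_mul (Nat.factorial_le_pow m) (Nat.mul_le_mul_right _ (two_pow_clog_le hn))
    _ = m ^ m * 2 ^ (r + 1 + m) * 2 * I.n := by ring

/-- All registers that bound loops are small. -/
theorem Ready.reg_le {I : WMaxPInstance} {s : State} (h : Ready I s) :
    ∀ b ∈ [1, 4, 5, 6, 8, 9, 10], s.reg b ≤ factor I.need * I.n := by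
  have hn : 0 < I.n := (Nat.zero_le _).trans_lt I.target.2
  have hpow : 0 < 2 ^ I.need := Nat.two_pow_pos _
  have hcodes := codes_le I
  have hbase : I.base I.need ≤ I.base I.need ^ (I.need + 2 ^ I.need) :=
    Nat.le_self_pow (by omega) _
  have hfac : I.need + 2 ^ I.need ≤ factor I.need := by
    have h1 : 0 < (I.need + 2 ^ I.need) ^ (I.need + 2 ^ I.need) := Nat.pow_pos (by omega)
    have h2 : I.need + 2 ^ I.need < 2 ^ (I.need + 2 ^ I.need) := Nat.lt_two_pow_self
    have h3 : 2 ^ (I.need + 2 ^ I.need) ≤ 2 ^ (I.need + 1 + (I.need + 2 ^ I.need)) :=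
      Nat.pow_le_pow_right two_pos (by omega)
    have h4 := Nat.le_mul_of_pos_left (2 ^ (I.need + 1 + (I.need + 2 ^ I.need))) h1
    simp only [factor]
    omega
  have h8 : I.need + 2 ^ I.need ≤ factor I.need * I.n :=
    hfac.trans (Nat.le_mul_of_pos_right _ hn)
  have h1 : I.n ≤ factor I.need * I.n := Nat.le_mul_of_pos_left _ (by omega)
  have hb : I.base I.need = Nat.clog 2 I.n + (I.need + 1) := rfl
  simp only [List.mem_cons, List.not_mem_nil, or_false, forall_eq_or_imp, forall_eq, h.n, h.need,
    h.bits, h.base, h.digits, h.codes, h.width]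
  omega

/-- The whole algorithm. -/
def program : Program :=
  .seq readInput.compile (.seq computeNeed.compile (.seq computeDigits.compile
    (.seq computeCodes.compile mainLoop.compile)))

/-- The constant factor of the running time. -/
def constant : ℕ := readInput.cost (fun _ => 1) + (computeNeed.cost (fun _ => 1) +
  (computeDigits.cost (fun _ => 1) + (computeCodes.cost (fun _ => 1) + mainLoop.cost (fun _ => 1))))

/-- Phases are timed separately because an early phase computes loop bounds of a later one, while
bounds must be fixed within a phase. The depth 7 is that of the main loop: code, round, two voters
and three colours. -/
theorem exec_phase {Y : ℕ} (hY : 1 ≤ Y) (c : Cmd) (s : State) (hwf : c.WF = true)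
    (hst : c.Static = true) (hd : c.depth ≤ 7) {B : List ℕ} (hB : ∀ b ∈ c.bounds, b ∈ B)
    (hb : ∀ b ∈ B, s.reg b ≤ Y) :
    ∃ t ≤ c.cost (fun _ => 1) * Y ^ 7, Exec c.compile s t (c.run s) := by
  obtain ⟨t, ht, h⟩ := c.exec hY hwf hst s fun b h => hb b (hB b h)
  exact ⟨t, ht.trans (Nat.mul_le_mul_left _ (Nat.pow_le_pow_right hY hd)), h⟩

theorem exec_program (I : WMaxPInstance) : ∃ t s, Exec program (RAM.input I.encode) t s ∧
    t ≤ constant * (factor I.need * I.n) ^ 7 ∧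
      (I.IsYes → s.reg 0 = 1) ∧ (¬ I.IsYes → s.reg 0 = 0) := by
  obtain ⟨hR, h0⟩ := ready I
  have hans := run_mainLoop hR h0
  have hle := hR.reg_le
  have hn : 0 < I.n := (Nat.zero_le _).trans_lt I.target.2
  generalize factor I.need * I.n = Y at hle ⊢
  have hY : 1 ≤ Y := by
    have := hle 1 (by decide)
    rw [hR.n] at this
    omega
  clear hR h0
  obtain ⟨t₁, ht₁, e₁⟩ := exec_phase hY readInput (RAM.input I.encode) (by decide) (by decide)
    (by decide) (B := []) (by decide) (by simp)
  generalize readInput.run (RAM.input I.encode) = s₁ at *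
  -- The size bounds are known for the fully prepared state. They carry back to the start of this
  -- phase, as neither it nor the later preparatory phases write the registers that bound its loops;
  -- the next two phases are treated alike.
  obtain ⟨t₂, ht₂, e₂⟩ := exec_phase hY computeNeed s₁ (by decide) (by decide) (by decide)
    (B := [1]) (by decide) fun b hb => by
      rw [← Cmd.run_reg computeNeed (by fin_cases hb; decide),
        ← Cmd.run_reg computeDigits (by fin_cases hb; decide),
        ← Cmd.run_reg computeCodes (by fin_cases hb; decide)]
      exact hle b (by fin_cases hb; decide)
  generalize computeNeed.run s₁ = s₂ at *
  obtain ⟨t₃, ht₃, e₃⟩ := exec_phase hY computeDigits s₂ (by decide) (by decide) (by decide)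
    (B := [4, 10]) (by decide) fun b hb => by
      rw [← Cmd.run_reg computeDigits (by fin_cases hb <;> decide),
        ← Cmd.run_reg computeCodes (by fin_cases hb <;> decide)]
      exact hle b (by fin_cases hb <;> decide)
  generalize computeDigits.run s₂ = s₃ at *
  obtain ⟨t₄, ht₄, e₄⟩ := exec_phase hY computeCodes s₃ (by decide) (by decide) (by decide)
    (B := [1, 6, 8]) (by decide) fun b hb => by
      rw [← Cmd.run_reg computeCodes (by fin_cases hb <;> decide)]
      exact hle b (by fin_cases hb <;> decide)
  generalize computeCodes.run s₃ = s₄ at *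
  obtain ⟨t₅, ht₅, e₅⟩ := exec_phase hY mainLoop s₄ (by decide) (by decide) (by decide)
    (by decide) hle
  refine ⟨_, _, .seq e₁ (.seq e₂ (.seq e₃ (.seq e₄ e₅))), ?_, hans⟩
  rw [constant, add_mul, add_mul, add_mul, add_mul]
  exact add_le_add ht₁ (add_le_add ht₂ (add_le_add ht₃ (add_le_add ht₄ ht₅)))

theorem le_inputSize (I : WMaxPInstance) : I.n ≤ RAM.inputSize I.encode := by
  have h := List.length_le_sum_of_one_le (I.encode.map fun a => Nat.size a + 1) (by
    intro i hi
    obtain ⟨a, -, rfl⟩ := List.mem_map.mp hi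
    omega)
  rw [List.length_map] at h
  refine le_trans ?_ h
  simp [WMaxPInstance.encode]
  omega

end Algorithm

end LiquidDemocracy

theorem mainTheorem9 :
    FixedParameterTractable LiquidDemocracy.WMaxPInstance.encode
      LiquidDemocracy.WMaxPInstance.IsYes
      (fun I : LiquidDemocracy.WMaxPInstance => I.req.toNat) := by
  open LiquidDemocracy Algorithm in
  refine ⟨program, fun r => constant * factor r ^ 7, 7, ?_, fun I => ?_⟩
  · exact (Primrec.nat_mul.comp (.const constant)
      (primrec_pow.comp primrec_factor (.const 7))).to_comp
  · obtain ⟨t, s, he, ht, h⟩ := exec_program I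
    refine ⟨t, s, he, ht.trans ?_, h⟩
    rw [mul_pow, ← mul_assoc]
    exact Nat.mul_le_mul
      (Nat.mul_le_mul_left _ (Nat.pow_le_pow_left (factor_mono I.need_le_req) 7))
      (Nat.pow_le_pow_left (le_inputSize I) 7)
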